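/- A \emph{cograph} is a graph with no induced path on four vertices. For a graph $G$ and a set $S$ of its vertices, the \emph{Seidel switch} of $G$ with respect to $S$ is the graph obtained from $G$ by complementing the adjacencies and nonadjacencies of all pairs of vertices with one element in $S$ and the other outside $S$. A graph is \emph{Cameron} if it is obtained from a cograph by a Seidel switch. \textbf{Corollary (recognition).} Cameron graphs can be recognized in $O(n^2)$ time: there is a program for a random access machine with words of $O(\log n)$ bits and unit-cost word operations which, given the adjacency matrix of any graph $G$ with $n$ vertices, halts after $O(n^2)$ steps and decides correctly whether $G$ is a Cameron graph. Moreover, for every graph $G$ and every vertex $x$ of $G$, the graph $G$ is Cameron if and only if the Seidel switch of $G$ with respect to the neighborhood $N(x)$ is a cograph. -/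

import Mathlib

open SimpleGraph Asymptotics Filter

/-! ## Cographs, Seidel switching, Cameron graphs -/

/-- A cograph is a graph without an induced path on four vertices. -/
def IsCograph {V : Type*} (G : SimpleGraph V) : Prop :=
  ¬ (pathGraph 4).IsIndContained G

/-- The Seidel switch of `G` with respect to `S`: adjacency is complemented exactly for the pairs
with one element in `S` and the other one outside of `S`. -/
def seidelSwitch {V : Type*} (G : SimpleGraph V) (S : Set V) : SimpleGraph V where
  Adj u v := Xor (G.Adj u v) (Xor (u ∈ S) (v ∈ S))
  symm := ⟨fun u v h => by rwa [G.adj_comm v u, _root_.xor_comm (v ∈ S)]⟩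
  loopless := ⟨fun u h => by simp [Xor] at h⟩

/-- A graph is Cameron if it is obtained from a cograph by a Seidel switch. -/
def IsCameron {V : Type*} (G : SimpleGraph V) : Prop :=
  ∃ (H : SimpleGraph V) (S : Set V), IsCograph H ∧ G = seidelSwitch H S

/-! ## A word RAM

Programs are structured programs over finitely many registers and finitely many zero-initialised
random access arrays of machine words (the registers and arrays that the program names). A machine
word is a natural number less than a bound `W`. Every arithmetic operation, comparison, register or
memory access, assignment and test costs one time unit. A computation in which an operation would
produce a number `≥ W` is stuck: it has no result. -/

namespace WordRAM

/-- The contents of the registers and of the arrays. -/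
structure State where
  reg : ℕ → ℕ
  arr : ℕ → ℕ → ℕ

/-- The binary word operations; subtraction is truncated at `0`, and the comparisons
return `1` (true) or `0` (false). -/
inductive BinOp
  | add | sub | mul | lt | eq

/-- The value of a binary operation. -/
def BinOp.apply : BinOp → ℕ → ℕ → ℕ
  | .add, x, y => x + y
  | .sub, x, y => x - y
  | .mul, x, y => x * y
  | .lt, x, y => if x < y then 1 else 0
  | .eq, x, y => if x = y then 1 else 0

/-- Expressions: a constant, the register `r`, the cell of the array `a` whose index is given by an
expression, or a binary operation. -/
inductive Expr
  | const (k : ℕ)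
  | reg (r : ℕ)
  | read (a : ℕ) (i : Expr)
  | bin (op : BinOp) (x y : Expr)

/-- The value of an expression in a state. -/
def Expr.eval (s : State) : Expr → ℕ
  | .const k => k
  | .reg r => s.reg r
  | .read a i => s.arr a (i.eval s)
  | .bin op x y => op.apply (x.eval s) (y.eval s)

/-- The time for evaluating an expression: one unit for each constant, access and operation. -/
def Expr.cost : Expr → ℕ
  | .const _ => 1
  | .reg _ => 1
  | .read _ i => i.cost + 1
  | .bin _ x y => x.cost + y.cost + 1

/-- Every number that occurs when the expression is evaluated (intermediate results and
addresses included) is a machine word, that is, less than `W`. -/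
def Expr.Fits (W : ℕ) (s : State) : Expr → Prop
  | .const k => k < W
  | .reg r => s.reg r < W
  | .read a i => i.Fits W s ∧ s.arr a (i.eval s) < W
  | .bin op x y => x.Fits W s ∧ y.Fits W s ∧ op.apply (x.eval s) (y.eval s) < W

/-- Programs. A test succeeds if its value is not `0`. -/
inductive Program
  | skip
  /-- register `r` := `e` -/
  | assign (r : ℕ) (e : Expr)
  /-- cell `i` of array `a` := `e` -/
  | write (a : ℕ) (i e : Expr)
  | seq (p q : Program)
  | ite (e : Expr) (p q : Program)
  | loop (e : Expr) (p : Program)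

/-- The state after the assignment of `x` to the register `r`. -/
def State.setReg (s : State) (r x : ℕ) : State :=
  { s with reg := Function.update s.reg r x }

/-- The state after the assignment of `x` to the cell `i` of the array `a`. -/
def State.setArr (s : State) (a i x : ℕ) : State :=
  { s with arr := Function.update s.arr a (Function.update (s.arr a) i x) }

/-- `Exec W p s t s'`: with machine words less than `W`, the program `p` started in the state `s`
halts after exactly `t` time units in the state `s'`. -/
inductive Exec (W : ℕ) : Program → State → ℕ → State → Prop
  | skip (s : State) : Exec W .skip s 1 s
  | assign (s : State) (r : ℕ) (e : Expr) (he : e.Fits W s) :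
      Exec W (.assign r e) s (e.cost + 1) (s.setReg r (e.eval s))
  | write (s : State) (a : ℕ) (i e : Expr) (hi : i.Fits W s) (he : e.Fits W s) :
      Exec W (.write a i e) s (i.cost + e.cost + 1) (s.setArr a (i.eval s) (e.eval s))
  | seq {p q : Program} {s s' s'' : State} {t t' : ℕ}
      (hp : Exec W p s t s') (hq : Exec W q s' t' s'') : Exec W (.seq p q) s (t + t') s''
  | ite_true {e : Expr} {p q : Program} {s s' : State} {t : ℕ} (he : e.Fits W s)
      (h : e.eval s ≠ 0) (hp : Exec W p s t s') : Exec W (.ite e p q) s (e.cost + 1 + t) s'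
  | ite_false {e : Expr} {p q : Program} {s s' : State} {t : ℕ} (he : e.Fits W s)
      (h : e.eval s = 0) (hq : Exec W q s t s') : Exec W (.ite e p q) s (e.cost + 1 + t) s'
  | loop_done {e : Expr} {p : Program} {s : State} (he : e.Fits W s)
      (h : e.eval s = 0) : Exec W (.loop e p) s (e.cost + 1) s
  | loop_step {e : Expr} {p : Program} {s s' s'' : State} {t t' : ℕ} (he : e.Fits W s)
      (h : e.eval s ≠ 0) (hp : Exec W p s t s') (hl : Exec W (.loop e p) s' t' s'') :
      Exec W (.loop e p) s (e.cost + 1 + t + t') s''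

open Classical in
/-- The initial state for the input graph `G` on the vertices `0, …, n - 1`: register `0` holds `n`
and array `0` holds the adjacency matrix of `G`, row by row; everything else is `0`. -/
noncomputable def inputGraph {n : ℕ} (G : SimpleGraph (Fin n)) : State where
  reg r := if r = 0 then n else 0
  arr a k := if a = 0 ∧ ∃ i j : Fin n, k = i * n + j ∧ G.Adj i j then 1 else 0

/-- The program `p` recognizes the class `C` of graphs in time `T`, with machine words of `O(log n)`
bits: for some `c` and with words less than `(n + 2) ^ c`, it halts on every graph with `n` vertices
after at most `T n` time units, with the answer `1` in register `0` if the graph belongs to `C` and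
with the answer `0` otherwise. -/
def Program.Recognizes (p : Program) (C : ∀ n : ℕ, SimpleGraph (Fin n) → Prop) (T : ℕ → ℕ) :
    Prop :=
  ∃ c : ℕ, ∀ (n : ℕ) (G : SimpleGraph (Fin n)), ∃ (t : ℕ) (s : State),
    Exec ((n + 2) ^ c) p (inputGraph G) t s ∧ t ≤ T n ∧
      (C n G → s.reg 0 = 1) ∧ (¬ C n G → s.reg 0 = 0)

end WordRAM

/-!
The second part of the theorem is a finite check. Switching `G` with respect to `N(x)` isolates
`x`, and every graph that is switching-equivalent to the disjoint union of `x` and a path on four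
vertices contains an induced path on four vertices (`InducesP4.exists_seidelSwitch`). So a Cameron
graph is recognized by testing one of its switches for being a cograph, and the remaining task is to
recognize cographs from the adjacency matrix in quadratic time.

The algorithm refines a partition of the vertices. It visits every vertex `x` once, as a pivot that
splits its class into `x` itself and groups of the other members: two members of the class are in
the same group if both or none of them are adjacent to `x` and if they have the same count, which is
the number of neighbours on the other side for a non-neighbour of `x`, and the number of
non-neighbours on the other side for a neighbour of `x`. The class is free of induced paths on four
vertices if and only if every group is, and both sides pass the test `SideGood`: vertices from
different groups are nonadjacent among the non-neighbours of `x`, adjacent among the neighbours of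
`x`, and the neighbourhoods (or non-neighbourhoods) on the other side are nested in the order of the
counts (`SideGood.of_p4FreeOn`, `p4FreeOn_of_sideGood`). When every vertex has been a pivot, all
classes are singletons, and the graph is a cograph if and only if all tests were passed.

Counting, sorting by counts and testing take time proportional to the number `n` of vertices, plus
the number of the pairs of class members that are on different sides of `x` or in different groups
of one side. Such a pair is separated by the pivot `x` and never considered again. Hence, for the
number `samePairs` of the pairs with the same label as a potential, a pivot step costs `O(n)` plus
the decrease of the potential (`Refines.samePairs_le`), and the total time is `O(n ^ 2)`.

Programs are verified with a calculus of weakest preconditions (`WordRAM.WP`) that also tracks the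
time. A program changes only the registers and arrays that it names (`Exec.agree`), so
specifications mention only what changes.
-/

/-! ### Switching and induced paths -/

/-- The vertices `a`, `b`, `c`, `d` induce a path of `G`, in this order. -/
def InducesP4 {V : Type*} (G : SimpleGraph V) (a b c d : V) : Prop :=
  G.Adj a b ∧ G.Adj b c ∧ G.Adj c d ∧ ¬ G.Adj a c ∧ ¬ G.Adj b d ∧ ¬ G.Adj a d

theorem isCograph_iff {V : Type*} {G : SimpleGraph V} :
    IsCograph G ↔ ∀ a b c d, ¬ InducesP4 G a b c d := by
  unfold IsCograph IsIndContained
  rw [← not_iff_not]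
  push Not
  constructor
  · rintro ⟨f⟩
    refine ⟨f 0, f 1, f 2, f 3, ?_⟩
    simp [InducesP4, f.map_adj_iff, pathGraph_adj]
  · rintro ⟨a, b, c, d, h1, h2, h3, h4, h5, h6⟩
    have hac : a ≠ c := by rintro rfl; exact h6 h3
    have had : a ≠ d := by rintro rfl; exact h5 h1.symm
    have hbd : b ≠ d := by rintro rfl; exact h6 h1
    have hab := h1.ne
    have hbc := h2.ne
    have hcd := h3.ne
    refine ⟨⟨⟨![a, b, c, d], ?_⟩, ?_⟩⟩
    · intro i j h
      fin_cases i <;> fin_cases j <;> simp_all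
    · intro i j
      change G.Adj (![a, b, c, d] i) (![a, b, c, d] j) ↔ _
      fin_cases i <;> fin_cases j <;>
        simp_all [pathGraph_adj, G.adj_comm]

theorem seidelSwitch_adj {V : Type*} {G : SimpleGraph V} {S : Set V} {u v : V} :
    (seidelSwitch G S).Adj u v ↔ (G.Adj u v ↔ (u ∈ S ↔ v ∈ S)) := by
  simp only [seidelSwitch, Xor]
  tauto

theorem seidelSwitch_seidelSwitch {V : Type*} (G : SimpleGraph V) (S : Set V) :
    seidelSwitch (seidelSwitch G S) S = G := by
  ext u v
  simp only [seidelSwitch_adj]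
  tauto

/-- Every switching class that contains the disjoint union of a vertex `x` and a path on four
vertices consists of graphs that contain an induced path on four vertices. -/
theorem InducesP4.exists_seidelSwitch {V : Type*} {K : SimpleGraph V} {x a b c d : V}
    (hx : ∀ v, ¬ K.Adj x v) (h : InducesP4 K a b c d) (U : Set V) :
    ∃ a' b' c' d', InducesP4 (seidelSwitch K U) a' b' c' d' := by
  by_contra! hcon
  obtain ⟨h1, h2, h3, h4, h5, h6⟩ := h
  have hx' : ∀ v, ¬ K.Adj v x := fun v hv => hx v hv.symm
  have h1' := h1.symm
  have h2' := h2.symm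
  have h4' : ¬ K.Adj c a := fun h => h4 h.symm
  have h5' : ¬ K.Adj d b := fun h => h5 h.symm
  -- These quadruples cover all positions of the five vertices relative to `U`.
  have k1 := hcon a b c d
  have k2 := hcon a c b d
  have k3 := hcon a d x b
  have k4 := hcon b a c x
  have k5 := hcon c d b x
  have k6 := hcon c x a d
  have k7 := hcon a x d b
  have k8 := hcon b c a x
  have k9 := hcon c a x d
  have k10 := hcon c b d x
  clear hcon
  simp only [InducesP4, seidelSwitch_adj, hx, hx', h1, h2, h3, h4, h5, h6, h1', h2', h4', h5',
    true_iff, false_iff] at k1 k2 k3 k4 k5 k6 k7 k8 k9 k10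
  by_cases a ∈ U <;> by_cases b ∈ U <;> by_cases c ∈ U <;> by_cases d ∈ U <;>
    by_cases x ∈ U <;> simp_all

theorem seidelSwitch_symmDiff {V : Type*} (G : SimpleGraph V) (S N : Set V) :
    seidelSwitch (seidelSwitch (seidelSwitch G S) N) {v | ¬ (v ∈ S ↔ v ∈ N)} = G := by
  ext u v
  simp only [seidelSwitch_adj, Set.mem_ofPred_eq]
  by_cases G.Adj u v <;> by_cases u ∈ S <;> by_cases v ∈ S <;> by_cases u ∈ N <;>
    by_cases v ∈ N <;> simp [*]

/-- A graph is Cameron if and only if isolating a vertex by switching gives a cograph. -/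
theorem isCameron_iff {V : Type*} (G : SimpleGraph V) (x : V) :
    IsCameron G ↔ IsCograph (seidelSwitch G (G.neighborSet x)) := by
  constructor
  · rintro ⟨H, S, hH, rfl⟩
    rw [isCograph_iff] at hH ⊢
    intro a b c d h
    set N := (seidelSwitch H S).neighborSet x with hN
    have hx : ∀ v, ¬ (seidelSwitch (seidelSwitch H S) N).Adj x v := by
      intro v hv
      rw [seidelSwitch_adj, hN] at hv
      simp at hv
    obtain ⟨a', b', c', d', h'⟩ := h.exists_seidelSwitch hx {v | ¬ (v ∈ S ↔ v ∈ N)}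
    refine hH a' b' c' d' ?_
    rwa [seidelSwitch_symmDiff] at h'
  · intro h
    exact ⟨_, _, h, (seidelSwitch_seidelSwitch G _).symm⟩

/-- No four vertices of `C` induce a path of `G`. -/
def P4FreeOn {V : Type*} (G : SimpleGraph V) (C : Set V) : Prop :=
  ∀ a ∈ C, ∀ b ∈ C, ∀ c ∈ C, ∀ d ∈ C, ¬ InducesP4 G a b c d

theorem P4FreeOn.mono {V : Type*} {G : SimpleGraph V} {C D : Set V} (h : P4FreeOn G D)
    (hCD : C ⊆ D) : P4FreeOn G C :=
  fun a ha b hb c hc d hd => h a (hCD ha) b (hCD hb) c (hCD hc) d (hCD hd)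

/-- `v` and `w`, on different sides of a pivot, are in the exceptional position from the point of
view of the side `β` of `v`: adjacent if `β = 0`, nonadjacent if `β = 1`. -/
def Opp {V : Type*} (G : SimpleGraph V) (β : ℕ) (v w : V) : Prop := ¬ (G.Adj v w ↔ β = 1)

open Classical in
/-- The number of entries of `L` that are in the exceptional position with respect to `v`. -/
noncomputable def oppCount {V : Type*} (G : SimpleGraph V) (β : ℕ) (L : List V) (v : V) : ℕ :=
  L.countP (fun w => decide (Opp G β v w))

theorem List.countP_lt_countP_of_imp {α : Type*} {p q : α → Bool} :
    ∀ {l : List α}, (∀ a ∈ l, p a → q a) → (∃ a ∈ l, q a ∧ ¬ p a) → l.countP p < l.countP q := by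
  intro l
  induction l with
  | nil => simp
  | cons b l ih =>
    intro h1 ⟨a, ha, hq, hp⟩
    have hle : l.countP p ≤ l.countP q :=
      List.countP_mono_left (fun a ha => h1 a (List.mem_cons_of_mem _ ha))
    rcases List.mem_cons.1 ha with rfl | ha
    · rw [List.countP_cons_of_neg hp, List.countP_cons_of_pos hq]
      omega
    · have := ih (fun a ha => h1 a (List.mem_cons_of_mem _ ha)) ⟨a, ha, hq, hp⟩
      have hb := h1 b List.mem_cons_self
      simp only [List.countP_cons]
      split_ifs <;> simp_all

theorem oppCount_lt {V : Type*} {G : SimpleGraph V} {β : ℕ} {L : List V} {u v : V}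
    (h : ∀ w ∈ L, Opp G β u w → Opp G β v w) {w : V} (hw : w ∈ L) (h1 : Opp G β v w)
    (h2 : ¬ Opp G β u w) : oppCount G β L u < oppCount G β L v :=
  List.countP_lt_countP_of_imp (by simpa using h) ⟨w, hw, by simpa using h1, by simpa using h2⟩

/-- The conditions that are tested for the side `β` of a pivot: the vertices of different groups
(a group is the set of the vertices with the same count) are adjacent exactly if `β = 1`, and the
exceptional neighbourhoods on the other side `L'` form a chain that is ordered by the counts. -/
def SideGood {V : Type*} (G : SimpleGraph V) (β : ℕ) (L L' : List V) : Prop :=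
  (∀ v ∈ L, ∀ u ∈ L, oppCount G β L' u < oppCount G β L' v → (G.Adj v u ↔ β = 1)) ∧
  (∀ u ∈ L, ∀ v ∈ L, oppCount G β L' u ≤ oppCount G β L' v →
    ∀ w ∈ L', Opp G β u w → Opp G β v w)

theorem SideGood.of_p4FreeOn {V : Type*} {G : SimpleGraph V} {β : ℕ} (hβ : β < 2) {x : V}
    {L L' : List V} {C : Set V} (hx : x ∈ C) (hL : ∀ v ∈ L, v ∈ C ∧ v ≠ x ∧ (G.Adj x v ↔ β = 1))
    (hL' : ∀ v ∈ L', v ∈ C ∧ v ≠ x ∧ ¬ (G.Adj x v ↔ β = 1)) (h : P4FreeOn G C) :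
    SideGood G β L L' := by
  have sym : ∀ u v, G.Adj u v ↔ G.Adj v u := fun u v => G.adj_comm u v
  have ex : ∀ u v, oppCount G β L' u ≤ oppCount G β L' v → ∀ w ∈ L', Opp G β u w →
      ¬ Opp G β v w → ∃ w' ∈ L', Opp G β v w' ∧ ¬ Opp G β u w' := by
    intro u v huv w hw h1 h2
    by_contra! hcon
    exact absurd (oppCount_lt hcon hw h1 h2) (not_lt.2 huv)
  constructor
  · intro v hv u hu huv
    obtain ⟨w, hw, h1, h2⟩ : ∃ w ∈ L', Opp G β v w ∧ ¬ Opp G β u w := by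
      by_contra! hcon
      have : oppCount G β L' v ≤ oppCount G β L' u :=
        List.countP_mono_left (by simpa using hcon)
      omega
    obtain ⟨hvC, hvx, hv⟩ := hL v hv
    obtain ⟨huC, hux, hu⟩ := hL u hu
    obtain ⟨hwC, hwx, hw⟩ := hL' w hw
    have k1 := h x hx w hwC v hvC u huC
    have k2 := h w hwC u huC x hx v hvC
    have k3 := h w hwC u huC v hvC x hx
    have k4 := h v hvC x hx u huC w hwC
    have hne : u ≠ v := by rintro rfl; omega
    unfold Opp at h1 h2
    unfold InducesP4 at k1 k2 k3 k4
    interval_cases β <;> grind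
  · intro u hu v hv huv w hw h1
    by_contra h2
    obtain ⟨w', hw', h3, h4⟩ := ex u v huv w hw h1 h2
    obtain ⟨hvC, hvx, hv⟩ := hL v hv
    obtain ⟨huC, hux, hu⟩ := hL u hu
    obtain ⟨hwC, hwx, hw⟩ := hL' w hw
    obtain ⟨hwC', hwx', hw'⟩ := hL' w' hw'
    have k1 := h u huC w hwC x hx w' hwC'
    have k2 := h u huC w hwC w' hwC' v hvC
    have k3 := h x hx w hwC u huC v hvC
    have k4 := h w hwC w' hwC' u huC x hx
    have k5 := h w' hwC' u huC v hvC w hwC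
    have k6 := h w hwC v hvC x hx u huC
    unfold Opp at h1 h2 h3 h4
    unfold InducesP4 at k1 k2 k3 k4 k5 k6
    interval_cases β <;> grind

/-- A vertex set that is split by the pivot `x` into groups passing the tests contains an induced
path on four vertices only if one of the groups does. Adjacent vertices on the side of the
non-neighbours of `x` have the same neighbours on the other side, and dually for nonadjacent
vertices on the side of the neighbours; thus a path would have to stay on one side, inside of one
group. -/
theorem p4FreeOn_of_sideGood {V : Type*} {G : SimpleGraph V} {x : V}
    {L L' : List V} {C : Set V} (hC : ∀ v ∈ C, v = x ∨ v ∈ L ∨ v ∈ L')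
    (hL : ∀ v ∈ L, v ≠ x ∧ ¬ G.Adj x v) (hL' : ∀ v ∈ L', G.Adj x v)
    (h0 : SideGood G 0 L L') (h1 : SideGood G 1 L' L)
    (hG0 : ∀ k, P4FreeOn G {v | v ∈ L ∧ oppCount G 0 L' v = k})
    (hG1 : ∀ k, P4FreeOn G {v | v ∈ L' ∧ oppCount G 1 L v = k}) : P4FreeOn G C := by
  have sym : ∀ u v, G.Adj u v → G.Adj v u := fun u v h => h.symm
  have opp0 : ∀ u v, Opp G 0 u v ↔ G.Adj u v := by simp [Opp]
  have opp1 : ∀ u v, Opp G 1 u v ↔ ¬ G.Adj u v := by simp [Opp]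
  have e0 : ∀ u ∈ L, ∀ v ∈ L, G.Adj u v → oppCount G 0 L' u = oppCount G 0 L' v := by
    intro u hu v hv huv
    rcases lt_trichotomy (oppCount G 0 L' u) (oppCount G 0 L' v) with h | h | h
    · simpa using (h0.1 v hv u hu h).1 huv.symm
    · exact h
    · simpa using (h0.1 u hu v hv h).1 huv
  have e1 : ∀ u ∈ L', ∀ v ∈ L', ¬ G.Adj u v → oppCount G 1 L u = oppCount G 1 L v := by
    intro u hu v hv huv
    rcases lt_trichotomy (oppCount G 1 L u) (oppCount G 1 L v) with h | h | h
    · exact absurd ((h1.1 v hv u hu h).2 rfl).symm huv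
    · exact h
    · exact absurd ((h1.1 u hu v hv h).2 rfl) huv
  have n0 : ∀ u ∈ L, ∀ v ∈ L, G.Adj u v → ∀ w ∈ L', G.Adj u w → G.Adj v w := by
    intro u hu v hv huv w hw
    simpa only [opp0] using h0.2 u hu v hv (e0 u hu v hv huv).le w hw
  have n1 : ∀ u ∈ L', ∀ v ∈ L', ¬ G.Adj u v → ∀ w ∈ L, G.Adj u w → G.Adj v w := by
    intro u hu v hv huv w hw
    have := h1.2 v hv u hu (e1 u hu v hv huv).ge w hw
    rw [opp1, opp1] at this
    tauto
  have ch : ∀ u ∈ L, ∀ v ∈ L, ∀ w ∈ L', ∀ z ∈ L', G.Adj u w → G.Adj v z → ¬ G.Adj u z →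
      G.Adj v w := by
    intro u hu v hv w hw z hz huw hvz huz
    rcases le_total (oppCount G 0 L' u) (oppCount G 0 L' v) with h | h
    · exact (opp0 _ _).1 (h0.2 u hu v hv h w hw ((opp0 _ _).2 huw))
    · exact absurd ((opp0 _ _).1 (h0.2 v hv u hu h z hz ((opp0 _ _).2 hvz))) huz
  have g0 : ∀ a b c d, a ∈ L → b ∈ L → c ∈ L → d ∈ L → ¬ InducesP4 G a b c d := by
    intro a b c d ha hb hc hd h
    have h1 := e0 a ha b hb h.1
    have h2 := e0 b hb c hc h.2.1
    have h3 := e0 c hc d hd h.2.2.1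
    exact hG0 _ a ⟨ha, rfl⟩ b ⟨hb, h1.symm⟩ c ⟨hc, (h1.trans h2).symm⟩ d
      ⟨hd, (h1.trans (h2.trans h3)).symm⟩ h
  have g1 : ∀ a b c d, a ∈ L' → b ∈ L' → c ∈ L' → d ∈ L' → ¬ InducesP4 G a b c d := by
    intro a b c d ha hb hc hd h
    have h1 := e1 a ha c hc h.2.2.2.1
    have h2 := e1 b hb d hd h.2.2.2.2.1
    have h3 := e1 a ha d hd h.2.2.2.2.2
    exact hG1 _ a ⟨ha, rfl⟩ b ⟨hb, (h3.trans h2.symm).symm⟩ c ⟨hc, h1.symm⟩ d ⟨hd, h3.symm⟩ h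
  intro a ha b hb c hc d hd h
  have g0 := g0 a b c d
  have g1 := g1 a b c d
  obtain ⟨h1, h2, h3, h4, h5, h6⟩ := id h
  have q1 : ¬ (a ∈ L ∧ b ∈ L ∧ c ∈ L') := fun ⟨p, q, r⟩ => h4 (n0 b q a p h1.symm c r h2)
  have q2 : ¬ (b ∈ L ∧ c ∈ L ∧ a ∈ L') := fun ⟨p, q, r⟩ => h4 (n0 b p c q h2 a r h1.symm).symm
  have q3 : ¬ (b ∈ L ∧ c ∈ L ∧ d ∈ L') := fun ⟨p, q, r⟩ => h5 (n0 c q b p h2.symm d r h3)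
  have q4 : ¬ (c ∈ L ∧ d ∈ L ∧ b ∈ L') := fun ⟨p, q, r⟩ => h5 (n0 c p d q h3 b r h2.symm).symm
  have q5 : ¬ (a ∈ L' ∧ c ∈ L' ∧ d ∈ L) :=
    fun ⟨p, q, r⟩ => h6 (n1 c q a p (fun h => h4 h.symm) d r h3)
  have q6 : ¬ (b ∈ L' ∧ d ∈ L' ∧ a ∈ L) := fun ⟨p, q, r⟩ => h6 (n1 b p d q h5 a r h1.symm).symm
  have q7 : ¬ (a ∈ L' ∧ d ∈ L' ∧ b ∈ L) := fun ⟨p, q, r⟩ => h5 (n1 a p d q h6 b r h1).symm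
  have q8 : ¬ (a ∈ L' ∧ d ∈ L' ∧ c ∈ L) :=
    fun ⟨p, q, r⟩ => h4 (n1 d q a p (fun h => h6 h.symm) c r h3.symm)
  have q9 : ¬ (a ∈ L ∧ d ∈ L ∧ b ∈ L' ∧ c ∈ L') :=
    fun ⟨p, q, r, r'⟩ => h5 (ch a p d q b r c r' h1 h3.symm h4).symm
  have q10 : ¬ (b ∈ L ∧ c ∈ L ∧ a ∈ L' ∧ d ∈ L') :=
    fun ⟨p, q, r, r'⟩ => h4 (ch b p c q a r d r' h1.symm h3 h5).symm
  have x1 : a = x → b ∉ L ∧ c ∉ L' ∧ d ∉ L' := by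
    rintro rfl
    exact ⟨fun hv => (hL _ hv).2 h1, fun hv => h4 (hL' _ hv), fun hv => h6 (hL' _ hv)⟩
  have x2 : b = x → a ∉ L ∧ c ∉ L ∧ d ∉ L' := by
    rintro rfl
    exact ⟨fun hv => (hL _ hv).2 h1.symm, fun hv => (hL _ hv).2 h2, fun hv => h5 (hL' _ hv)⟩
  have x3 : c = x → a ∉ L' ∧ b ∉ L ∧ d ∉ L := by
    rintro rfl
    exact ⟨fun hv => h4 (hL' _ hv).symm, fun hv => (hL _ hv).2 h2.symm, fun hv => (hL _ hv).2 h3⟩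
  have x4 : d = x → a ∉ L' ∧ b ∉ L' ∧ c ∉ L := by
    rintro rfl
    exact ⟨fun hv => h6 (hL' _ hv).symm, fun hv => h5 (hL' _ hv).symm,
      fun hv => (hL _ hv).2 h3.symm⟩
  have y1 : a ≠ b := h1.ne
  have y2 : b ≠ c := h2.ne
  have y3 : c ≠ d := h3.ne
  have y4 : a ≠ c := by rintro rfl; exact h6 h3
  have y5 : b ≠ d := by rintro rfl; exact h6 h1
  have y6 : a ≠ d := by rintro rfl; exact h5 h1.symm
  have ca := hC a ha
  have cb := hC b hb
  have cc := hC c hc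
  have cd := hC d hd
  clear * - g0 g1 h q1 q2 q3 q4 q5 q6 q7 q8 q9 q10 x1 x2 x3 x4 y1 y2 y3 y4 y5 y6 ca cb cc cd
  rcases ca with rfl | ca | ca <;> rcases cb with rfl | cb | cb <;>
    rcases cc with rfl | cc | cc <;> rcases cd with rfl | cd | cd <;> simp_all

/-! ### Total correctness of word RAM programs -/

namespace WordRAM

/-- The registers that a program may change. -/
def Program.regs : Program → List ℕ
  | .skip => []
  | .assign r _ => [r]
  | .write _ _ _ => []
  | .seq p q => p.regs ++ q.regs
  | .ite _ p q => p.regs ++ q.regs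
  | .loop _ p => p.regs

/-- The arrays that a program may change. -/
def Program.arrs : Program → List ℕ
  | .skip => []
  | .assign _ _ => []
  | .write a _ _ => [a]
  | .seq p q => p.arrs ++ q.arrs
  | .ite _ p q => p.arrs ++ q.arrs
  | .loop _ p => p.arrs

/-- The states differ at most in the registers from `R` and in the arrays from `A`. -/
def Agree (R A : List ℕ) (s s' : State) : Prop :=
  (∀ r, r ∉ R → s'.reg r = s.reg r) ∧ ∀ a, a ∉ A → s'.arr a = s.arr a

theorem Agree.refl (R A : List ℕ) (s : State) : Agree R A s s := ⟨fun _ _ => rfl, fun _ _ => rfl⟩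

theorem Agree.trans {R A : List ℕ} {s s' s'' : State} (h : Agree R A s s')
    (h' : Agree R A s' s'') : Agree R A s s'' :=
  ⟨fun r hr => (h'.1 r hr).trans (h.1 r hr), fun a ha => (h'.2 a ha).trans (h.2 a ha)⟩

theorem Agree.mono {R A R' A' : List ℕ} {s s' : State} (h : Agree R A s s')
    (hR : R ⊆ R') (hA : A ⊆ A') : Agree R' A' s s' :=
  ⟨fun r hr => h.1 r fun h => hr (hR h), fun a ha => h.2 a fun h => ha (hA h)⟩

theorem Agree.setReg {R A : List ℕ} {s s' : State} (h : Agree R A s s') {r : ℕ} (hr : r ∈ R)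
    (x : ℕ) : Agree R A s (s'.setReg r x) := by
  refine ⟨fun r' hr' => ?_, h.2⟩
  have : r' ≠ r := by rintro rfl; exact hr' hr
  simpa [State.setReg, this] using h.1 r' hr'

theorem Exec.agree {W : ℕ} {p : Program} {s s' : State} {t : ℕ} (h : Exec W p s t s') :
    Agree p.regs p.arrs s s' := by
  induction h with
  | skip s => exact Agree.refl _ _ _
  | assign s r e he => exact (Agree.refl _ _ _).setReg (by simp [Program.regs]) _
  | write s a i e hi he =>
    refine ⟨fun _ _ => rfl, fun a' ha' => ?_⟩
    have : a' ≠ a := by simpa [Program.arrs] using ha'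
    simp [State.setArr, this]
  | seq hp hq ihp ihq =>
    exact (ihp.mono (by simp [Program.regs]) (by simp [Program.arrs])).trans
      (ihq.mono (by simp [Program.regs]) (by simp [Program.arrs]))
  | ite_true he h hp ih => exact ih.mono (by simp [Program.regs]) (by simp [Program.arrs])
  | ite_false he h hp ih => exact ih.mono (by simp [Program.regs]) (by simp [Program.arrs])
  | loop_done he h => exact Agree.refl _ _ _
  | loop_step he h hp hl ihp ihl => exact Agree.trans ihp ihl

/-- Started in the state `s`, the program `p` halts after some time `t` in a state `s'` with
`Q s' t`. -/
def WP (W : ℕ) (p : Program) (Q : State → ℕ → Prop) (s : State) : Prop :=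
  ∃ t s', Exec W p s t s' ∧ Q s' t

variable {W : ℕ} {p q : Program} {s : State} {Q : State → ℕ → Prop}

theorem WP.skip (h : Q s 1) : WP W .skip Q s := ⟨_, _, .skip s, h⟩

theorem WP.assign {r : ℕ} {e : Expr} (he : e.Fits W s)
    (h : Q (s.setReg r (e.eval s)) (e.cost + 1)) : WP W (.assign r e) Q s :=
  ⟨_, _, .assign s r e he, h⟩

theorem WP.write {a : ℕ} {i e : Expr} (hi : i.Fits W s) (he : e.Fits W s)
    (h : Q (s.setArr a (i.eval s) (e.eval s)) (i.cost + e.cost + 1)) : WP W (.write a i e) Q s :=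
  ⟨_, _, .write s a i e hi he, h⟩

theorem WP.seq (h : WP W p (fun s' t => WP W q (fun s'' t' => Q s'' (t + t')) s') s) :
    WP W (.seq p q) Q s := by
  obtain ⟨t, s', he, t', s'', he', hQ⟩ := h
  exact ⟨_, _, .seq he he', hQ⟩

theorem WP.ite {e : Expr} (he : e.Fits W s)
    (h1 : e.eval s ≠ 0 → WP W p (fun s' t => Q s' (e.cost + 1 + t)) s)
    (h0 : e.eval s = 0 → WP W q (fun s' t => Q s' (e.cost + 1 + t)) s) :
    WP W (.ite e p q) Q s := by
  by_cases h : e.eval s = 0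
  · obtain ⟨t, s', hp, hQ⟩ := h0 h
    exact ⟨_, _, .ite_false he h hp, hQ⟩
  · obtain ⟨t, s', hp, hQ⟩ := h1 h
    exact ⟨_, _, .ite_true he h hp, hQ⟩

/-- `for r := 0, …, e - 1 do p`, where `e` is evaluated again before each round. -/
def Program.forLoop (r : ℕ) (e : Expr) (p : Program) : Program :=
  .seq (.assign r (.const 0))
    (.loop (.bin .lt (.reg r) e) (.seq p (.assign r (.bin .add (.reg r) (.const 1)))))

/-- The rule for `for` loops. The invariant `I i s' t` speaks about the state `s'` before round `i`
and about the time `t` that has been spent. -/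
theorem WP.forLoop {r : ℕ} {e : Expr} {N : ℕ} (I : ℕ → State → ℕ → Prop) (R A : List ℕ)
    (hR : p.regs = R) (hA : p.arrs = A) (hN : N < W) (hW : 1 < W) (hr : r ∉ R)
    (he : ∀ s', Agree (r :: R) A s s' → e.Fits W s' ∧ e.eval s' = N)
    (h0 : I 0 (s.setReg r 0) 2)
    (hI : ∀ i < N, ∀ s' t, Agree (r :: R) A s s' → s'.reg r = i → I i s' t →
      WP W p (fun s'' t' => I (i + 1) (s''.setReg r (i + 1)) (t + t' + e.cost + 7)) s')
    (hQ : ∀ s' t, Agree (r :: R) A s s' → I N s' t → Q s' (t + e.cost + 3)) :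
    WP W (.forLoop r e p) Q s := by
  subst hR hA
  have key : ∀ k i s' t, i + k = N → Agree (r :: p.regs) p.arrs s s' → s'.reg r = i → I i s' t →
      WP W (.loop (.bin .lt (.reg r) e) (.seq p (.assign r (.bin .add (.reg r) (.const 1)))))
        (fun s'' t' => Q s'' (t + t')) s' := by
    intro k
    induction k with
    | zero =>
      intro i s' t hi hs hri hIi
      obtain ⟨hef, hee⟩ := he s' hs
      obtain rfl : i = N := hi
      refine ⟨_, _, .loop_done ?_ ?_, ?_⟩
      · simp [Expr.Fits, BinOp.apply, hef, hee, Expr.eval, hri, hN]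
        omega
      · simp [Expr.eval, BinOp.apply, hee, hri]
      · have := hQ s' t hs hIi
        simp only [Expr.cost]
        convert this using 1
        omega
    | succ k ih =>
      intro i s' t hi hs hri hIi
      obtain ⟨hef, hee⟩ := he s' hs
      obtain ⟨t', s'', hex, hIn⟩ := hI i (by omega) s' t hs hri hIi
      have hag := hex.agree
      have hri' : s''.reg r = i := (hag.1 r hr).trans hri
      have hs2 : Agree (r :: p.regs) p.arrs s s'' :=
        hs.trans (hag.mono (List.subset_cons_self _ _) (List.Subset.refl _))
      obtain ⟨t'', s3, hex', hQ'⟩ := ih (i + 1) _ _ (by omega)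
        (hs2.setReg List.mem_cons_self (i + 1)) (by simp [State.setReg]) hIn
      have hstep : Exec W (.assign r (.bin .add (.reg r) (.const 1))) s'' 4
          (s''.setReg r (i + 1)) := by
        have := Exec.assign (W := W) s'' r (.bin .add (.reg r) (.const 1))
          (by simp [Expr.Fits, BinOp.apply, Expr.eval, hri']; omega)
        simpa [Expr.eval, BinOp.apply, hri', Expr.cost] using this
      refine ⟨_, _, .loop_step ?_ ?_ (.seq hex hstep) hex', ?_⟩
      · simp [Expr.Fits, BinOp.apply, hef, hee, Expr.eval, hri]
        split_ifs <;> omega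
      · simp [Expr.eval, BinOp.apply, hee, hri]
        omega
      · simp only [Expr.cost]
        convert hQ' using 1
        omega
  refine WP.seq (WP.assign (by simp [Expr.Fits]; omega) ?_)
  exact key N 0 _ _ (by simp) ((Agree.refl _ _ _).setReg List.mem_cons_self _)
    (by simp [State.setReg, Expr.eval]) h0

end WordRAM

/-! ### Tests and adjacency queries -/

/-!
Conventions of the recognition program. Register `0` holds `n`, register `1` the flag that tells
whether all tests were passed so far, and register `2` the pivot. Arrays `0` and `1` hold the input
matrix and the adjacency matrix of the graph that is tested, array `2` the labels of the classes.
The non-neighbours of the pivot in its class (side `0`) are listed in array `3`, the neighbours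
(side `1`) in array `4`; the registers of the same numbers hold the lengths of these lists. Array
`5` holds the sorted list of a side, and the other registers are local to the subprograms.
-/

namespace WordRAM

variable {W n : ℕ} {s : State} {Q : State → ℕ → Prop} {H : SimpleGraph ℕ}

/-- Register `1` is a flag that tells whether the proposition `P` holds. -/
def Flag (s : State) (P : Prop) : Prop := (s.reg 1 = 1 ∧ P) ∨ (s.reg 1 = 0 ∧ ¬ P)

theorem Flag.congr {s' : State} {P P' : Prop} (h : Flag s P) (hs : s'.reg 1 = s.reg 1)
    (hP : P ↔ P') : Flag s' P' := by
  unfold Flag at *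
  rwa [hs, ← hP]

/-- The array `a` starts with the entries of the list `L`. -/
def Holds (s : State) (a : ℕ) (L : List ℕ) : Prop := ∀ i (h : i < L.length), s.arr a i = L[i]

theorem Holds.congr {s' : State} {a : ℕ} {L : List ℕ} (h : Holds s a L)
    (hs : s'.arr a = s.arr a) : Holds s' a L := by
  unfold Holds at *
  rwa [hs]

theorem Holds.mem {a : ℕ} {L : List ℕ} (h : Holds s a L) {i : ℕ} (hi : i < L.length) :
    s.arr a i ∈ L := by
  rw [h i hi]
  exact List.getElem_mem hi

theorem Holds.forall_iff {a : ℕ} {L : List ℕ} (h : Holds s a L) {p : ℕ → Prop} :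
    (∀ i < L.length, p (s.arr a i)) ↔ ∀ v ∈ L, p v := by
  constructor
  · intro hp v hv
    obtain ⟨i, hi, rfl⟩ := List.mem_iff_getElem.1 hv
    rw [← h i hi]
    exact hp i hi
  · intro hp i hi
    exact hp _ (h.mem hi)

theorem Holds.append {a : ℕ} {L : List ℕ} (h : Holds s a L) (v : ℕ) :
    Holds (s.setArr a L.length v) a (L ++ [v]) := by
  intro i hi
  simp only [List.length_append, List.length_singleton] at hi
  rcases Nat.lt_succ_iff_lt_or_eq.1 hi with hi | rfl
  · rw [List.getElem_append_left hi, ← h i hi]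
    simp [State.setArr, hi.ne]
  · simp [State.setArr]

/-- Clears the flag if the condition holds in some round. -/
def Program.checkAll (r : ℕ) (e cond : Expr) : Program :=
  .forLoop r e (.ite cond (.assign 1 (.const 0)) .skip)

theorem WP.checkAll {r : ℕ} {e cond : Expr} {N : ℕ} {P : Prop} {good : ℕ → Prop}
    (hN : N < W) (hW : 1 < W) (hr : r ≠ 1) (hF : Flag s P)
    (he : ∀ s', Agree [r, 1] [] s s' → e.Fits W s' ∧ e.eval s' = N)
    (hc : ∀ s', Agree [r, 1] [] s s' → s'.reg r < N →
      cond.Fits W s' ∧ (cond.eval s' = 0 ↔ good (s'.reg r)))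
    (hQ : ∀ s' t, Agree [r, 1] [] s s' → Flag s' (P ∧ ∀ j < N, good j) →
      t ≤ N * (cond.cost + e.cost + 10) + e.cost + 5 → Q s' t) :
    WP W (.checkAll r e cond) Q s := by
  refine WP.forLoop (N := N) (fun i s' t => Flag s' (P ∧ ∀ j < i, good j) ∧
    t ≤ i * (cond.cost + e.cost + 10) + 2) [1] [] rfl rfl hN hW (by simpa using hr) he ?_ ?_ ?_
  · exact ⟨hF.congr (by simp [State.setReg, hr.symm]) (by simp), by simp⟩
  · rintro i hi s' t hs rfl ⟨hFi, ht⟩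
    obtain ⟨hcf, hce⟩ := hc s' hs hi
    have hstep : (∀ j < s'.reg r + 1, good j) ↔ (∀ j < s'.reg r, good j) ∧ good (s'.reg r) := by
      constructor
      · exact fun h => ⟨fun j hj => h j (by omega), h _ (by omega)⟩
      · rintro ⟨h1, h2⟩ j hj
        rcases Nat.lt_succ_iff_lt_or_eq.1 hj with hj | rfl
        exacts [h1 j hj, h2]
    have ht' : (s'.reg r + 1) * (cond.cost + e.cost + 10) =
      s'.reg r * (cond.cost + e.cost + 10) + (cond.cost + e.cost + 10) := Nat.succ_mul _ _
    refine WP.ite hcf (fun h => ?_) (fun h => ?_)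
    · refine WP.assign (by simp [Expr.Fits]; omega) ⟨Or.inr ⟨?_, ?_⟩, ?_⟩
      · simp [State.setReg, hr.symm, Expr.eval]
      · rw [hstep]
        tauto
      · simp only [Expr.cost]
        omega
    · refine WP.skip ⟨hFi.congr ?_ ?_, ?_⟩
      · simp [State.setReg, hr.symm]
      · rw [hstep]
        tauto
      · omega
  · rintro s' t hs ⟨hFi, ht⟩
    exact hQ s' _ hs hFi (by omega)

/-- Register `0` holds `n`, and array `1` holds the adjacency matrix of the subgraph of `H` that is
induced by `0, …, n - 1`. -/
structure Mat (n : ℕ) (H : SimpleGraph ℕ) (s : State) : Prop where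
  reg : s.reg 0 = n
  arr : ∀ u < n, ∀ v < n, (s.arr 1 (u * n + v) = 1 ∧ H.Adj u v) ∨
    (s.arr 1 (u * n + v) = 0 ∧ ¬ H.Adj u v)

theorem Mat.congr {s' : State} (h : Mat n H s) (h0 : s'.reg 0 = s.reg 0)
    (h1 : s'.arr 1 = s.arr 1) : Mat n H s' := by
  refine ⟨h0.trans h.reg, ?_⟩
  rw [h1]
  exact h.arr

/-- Whether the adjacency of `u` and `v` is as usual on the side `β` of a pivot. -/
def sameE (β : ℕ) (u v : Expr) : Expr :=
  .bin .eq (.read 1 (.bin .add (.bin .mul u (.reg 0)) v)) (.const β)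

/-- Whether `u` on the side `β` of a pivot and `v` are in the exceptional position. -/
def oppE (β : ℕ) (u v : Expr) : Expr := .bin .eq (sameE β u v) (.const 0)

theorem mul_add_lt_sq {u v n : ℕ} (hu : u < n) (hv : v < n) : u * n + v < n * n := by
  have : (u + 1) * n ≤ n * n := Nat.mul_le_mul_right n hu
  rw [Nat.succ_mul] at this
  omega

theorem sameE_spec {β : ℕ} {u v : Expr} (hM : Mat n H s) (hW : 2 * (n * n) + 8 * n + 8 ≤ W)
    (hβ : β < 2) (huf : u.Fits W s) (hvf : v.Fits W s) (hu : u.eval s < n) (hv : v.eval s < n) :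
    (sameE β u v).Fits W s ∧ (((sameE β u v).eval s = 1 ∧ ¬ Opp H β (u.eval s) (v.eval s)) ∨
      ((sameE β u v).eval s = 0 ∧ Opp H β (u.eval s) (v.eval s))) := by
  have h1 := mul_add_lt_sq hu hv
  have h2 := hM.arr _ hu _ hv
  have h0 := hM.reg
  constructor
  · simp only [sameE, Expr.Fits, Expr.eval, BinOp.apply, h0, huf, hvf, true_and]
    refine ⟨⟨⟨⟨?_, ?_⟩, ?_⟩, ?_⟩, ?_, ?_⟩
    · omega
    · omega
    · omega
    · omega
    · omega
    · split_ifs <;> omega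
  · simp only [sameE, Expr.eval, BinOp.apply, h0, Opp]
    rcases h2 with ⟨h2, h3⟩ | ⟨h2, h3⟩ <;> simp only [h2, h3] <;> interval_cases β <;> simp

theorem oppE_spec {β : ℕ} {u v : Expr} (hM : Mat n H s) (hW : 2 * (n * n) + 8 * n + 8 ≤ W)
    (hβ : β < 2) (huf : u.Fits W s) (hvf : v.Fits W s) (hu : u.eval s < n) (hv : v.eval s < n) :
    (oppE β u v).Fits W s ∧ (((oppE β u v).eval s = 1 ∧ Opp H β (u.eval s) (v.eval s)) ∨
      ((oppE β u v).eval s = 0 ∧ ¬ Opp H β (u.eval s) (v.eval s))) := by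
  obtain ⟨h1, h2⟩ := sameE_spec hM hW hβ huf hvf hu hv
  constructor
  · refine ⟨h1, ?_, ?_⟩
    · simp only [Expr.Fits]
      omega
    · simp only [BinOp.apply]
      split_ifs <;> omega
  · simp only [oppE, Expr.eval, BinOp.apply]
    rcases h2 with ⟨h2, h3⟩ | ⟨h2, h3⟩ <;> simp [h2, h3]

/-- The label of the group of those vertices on the side `β` of the pivot `x` that have the
count `c`. Different groups get different labels, also for different pivots. -/
def code (n x β c : ℕ) : ℕ := ((x + 1) * (n + 1) + c) * 2 + β

/-- The label of a group for the pivot in register `2` and the count `c`. -/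
def codeE (β : ℕ) (c : Expr) : Expr :=
  .bin .add (.bin .mul (.bin .add (.bin .mul (.bin .add (.reg 2) (.const 1))
    (.bin .add (.reg 0) (.const 1))) c) (.const 2)) (.const β)

theorem code_inj {n x β c c' : ℕ} : code n x β c = code n x β c' ↔ c = c' := by
  unfold code
  omega

theorem code_lt {n x β c : ℕ} (hβ : β < 2) (hc : c ≤ n) :
    code n x β c < 2 * ((x + 2) * (n + 1)) := by
  have : (x + 2) * (n + 1) = (x + 1) * (n + 1) + (n + 1) := by ring
  unfold code
  omega

theorem codeE_spec {β x : ℕ} {c : Expr} (hM : Mat n H s) (hW : 2 * (n * n) + 8 * n + 8 ≤ W)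
    (hβ : β < 2) (hx : s.reg 2 = x) (hxn : x < n) (hcf : c.Fits W s) (hc : c.eval s ≤ n) :
    (codeE β c).Fits W s ∧ (codeE β c).eval s = code n x β (c.eval s) := by
  have h0 := hM.reg
  have h1 : (x + 1) * (n + 1) ≤ n * n + n :=
    calc (x + 1) * (n + 1) ≤ n * (n + 1) := Nat.mul_le_mul_right _ hxn
      _ = n * n + n := by ring
  constructor
  · simp only [codeE, Expr.Fits, Expr.eval, BinOp.apply, h0, hx, hcf, true_and]
    repeat' apply And.intro
    all_goals omega
  · simp [codeE, code, Expr.eval, BinOp.apply, h0, hx]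

end WordRAM

/-! ### One side of a pivot -/

namespace WordRAM

variable {W n : ℕ} {s : State} {Q : State → ℕ → Prop} {H : SimpleGraph ℕ}

/-- Adds to register `8` the number of entries of the list `o` that are in the exceptional position
with respect to the vertex in register `7`. -/
def Program.countOpp (β o : ℕ) : Program :=
  .forLoop 6 (.reg o) (.assign 8 (.bin .add (.reg 8) (oppE β (.reg 7) (.read o (.reg 6)))))

/-- The list `L` of vertices is stored in the array `a`, and its length in the register `a`. -/
structure Stored (n : ℕ) (s : State) (a : ℕ) (L : List ℕ) : Prop where
  len : s.reg a = L.length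
  holds : Holds s a L
  lt : ∀ v ∈ L, v < n
  nodup : L.Nodup

theorem Stored.congr {s' : State} {a : ℕ} {L : List ℕ} (h : Stored n s a L)
    (h0 : s'.reg a = s.reg a) (h1 : s'.arr a = s.arr a) : Stored n s' a L :=
  ⟨h0.trans h.len, h.holds.congr h1, h.lt, h.nodup⟩

theorem length_le_of_nodup_of_lt {L : List ℕ} (h : L.Nodup) (hlt : ∀ v ∈ L, v < n) :
    L.length ≤ n := by
  have := (List.subperm_of_subset h (l₂ := List.range n) (fun v hv => by simpa using hlt v hv))
  simpa using this.length_le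

theorem Stored.length_le {a : ℕ} {L : List ℕ} (h : Stored n s a L) : L.length ≤ n :=
  length_le_of_nodup_of_lt h.nodup h.lt

theorem oppCount_append {V : Type*} {G : SimpleGraph V} {β : ℕ} {L L' : List V} {v : V} :
    oppCount G β (L ++ L') v = oppCount G β L v + oppCount G β L' v := List.countP_append

open Classical in
theorem oppCount_singleton {V : Type*} {G : SimpleGraph V} {β : ℕ} {v w : V} :
    oppCount G β [w] v = if Opp G β v w then 1 else 0 := by
  simp [oppCount, List.countP_cons]

theorem oppCount_le {V : Type*} {G : SimpleGraph V} {β : ℕ} {L : List V} {v : V} :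
    oppCount G β L v ≤ L.length := List.countP_le_length

theorem WP.countOpp {β o v : ℕ} {L' : List ℕ} (hW : 2 * (n * n) + 8 * n + 8 ≤ W)
    (hβ : β < 2) (ho : o = 3 ∨ o = 4) (hM : Mat n H s) (hL' : Stored n s o L')
    (hv : s.reg 7 = v) (hvn : v < n) (h8 : s.reg 8 = 0)
    (hQ : ∀ s' t, Agree [6, 8] [] s s' → s'.reg 8 = oppCount H β L' v →
      t ≤ L'.length * 30 + 10 → Q s' t) :
    WP W (.countOpp β o) Q s := by
  have hlen := hL'.length_le
  have ho6 : o ∉ [6, 8] := by rcases ho with rfl | rfl <;> decide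
  refine WP.forLoop (N := L'.length) (fun i s' t => s'.reg 8 = oppCount H β (L'.take i) v ∧
    t ≤ i * 30 + 2) [8] [] rfl rfl (by omega) (by omega) (by decide) ?_ ?_ ?_ ?_
  · intro s' hs
    have h1 := (hs.1 o ho6).trans hL'.len
    simp only [Expr.Fits, Expr.eval, h1, and_true]
    omega
  · simp [State.setReg, h8, oppCount]
  · rintro i hi s' t hs hi' ⟨hc, ht⟩
    have hM' : Mat n H s' := hM.congr (hs.1 0 (by decide)) (hs.2 1 (by decide))
    have hS' : Stored n s' o L' := hL'.congr (hs.1 o ho6) (hs.2 o (by simp))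
    have h7 : s'.reg 7 = v := (hs.1 7 (by decide)).trans hv
    have hLi : s'.arr o i = L'[i] := hS'.holds i hi
    have hLn : L'[i] < n := hL'.lt _ (List.getElem_mem hi)
    obtain ⟨hf, he⟩ := oppE_spec (β := β) (u := .reg 7) (v := .read o (.reg 6)) hM' hW hβ
      (by simp only [Expr.Fits]; omega) (by simp only [Expr.Fits, Expr.eval, hi', hLi]; omega)
      (by simp only [Expr.eval]; omega) (by simp only [Expr.eval, hi', hLi]; omega)
    simp only [Expr.eval, hi', hLi, h7] at he
    have hcl : oppCount H β (L'.take i) v ≤ n :=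
      oppCount_le.trans ((List.length_take_le _ _).trans (by omega))
    refine WP.assign ⟨by simp only [Expr.Fits]; omega, hf, ?_⟩ ⟨?_, ?_⟩
    · simp only [BinOp.apply, Expr.eval]
      rcases he with he | he <;> omega
    · rw [← List.take_append_getElem hi, oppCount_append, oppCount_singleton]
      simp only [State.setReg, Expr.eval, BinOp.apply]
      rcases he with ⟨he, he'⟩ | ⟨he, he'⟩ <;> simp [he, he', hc]
    · simp only [Expr.cost, oppE, sameE]
      omega
  · rintro s' t hs ⟨hc, ht⟩
    rw [List.take_length] at hc
    exact hQ s' _ hs hc (by simp only [Expr.cost]; omega)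

/-- Computes the groups on the side `β` of the pivot in register `2`, whose vertices are in the
list `a`, the other side being in the list `o`. -/
def Program.relabel (β a o : ℕ) : Program :=
  .forLoop 5 (.reg a) (.seq (.assign 7 (.read a (.reg 5))) (.seq (.assign 8 (.const 0))
    (.seq (.countOpp β o) (.write 2 (.reg 7) (codeE β (.reg 8))))))

theorem WP.relabel {β a o x : ℕ} {L L' : List ℕ} (hW : 2 * (n * n) + 8 * n + 8 ≤ W)
    (hβ : β < 2) (ha : a = 3 ∨ a = 4) (ho : o = 3 ∨ o = 4) (hM : Mat n H s)
    (hL : Stored n s a L) (hL' : Stored n s o L') (hx : s.reg 2 = x) (hxn : x < n)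
    (hQ : ∀ s' t, Agree [5, 6, 7, 8] [2] s s' →
      (∀ v, s'.arr 2 v = if v ∈ L then code n x β (oppCount H β L' v) else s.arr 2 v) →
      t ≤ L.length * (L'.length * 30 + 50) + 10 → Q s' t) :
    WP W (.relabel β a o) Q s := by
  have hlen := hL.length_le
  have hlen' := hL'.length_le
  refine WP.forLoop (N := L.length) (fun i s' t =>
    (∀ v, s'.arr 2 v = if v ∈ L.take i then code n x β (oppCount H β L' v) else s.arr 2 v) ∧
    t ≤ i * (L'.length * 30 + 50) + 2) [7, 8, 6, 8, 6] [2] rfl rfl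
    (by omega) (by omega) (by decide) ?_ ?_ ?_ ?_
  · intro s' hs
    have h1 := (hs.1 a (by simp; omega)).trans hL.len
    simp only [Expr.Fits, Expr.eval, h1, and_true]
    omega
  · simp [State.setReg]
  · rintro i hi s' t hs hi' ⟨hc, ht⟩
    have hM' : Mat n H s' := hM.congr (hs.1 0 (by decide)) (hs.2 1 (by decide))
    have hS : Stored n s' a L := hL.congr (hs.1 a (by simp; omega)) (hs.2 a (by simp; omega))
    have hS' : Stored n s' o L' := hL'.congr (hs.1 o (by simp; omega)) (hs.2 o (by simp; omega))
    have hLi : s'.arr a i = L[i] := hS.holds i hi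
    have hLn : L[i] < n := hL.lt _ (List.getElem_mem hi)
    have hx' : s'.reg 2 = x := (hs.1 2 (by decide)).trans hx
    have ht' : (i + 1) * (L'.length * 30 + 50) = i * (L'.length * 30 + 50) +
      (L'.length * 30 + 50) := Nat.succ_mul _ _
    refine WP.seq (WP.assign (by simp only [Expr.Fits, Expr.eval, hi', hLi]; omega) ?_)
    refine WP.seq (WP.assign (by simp only [Expr.Fits]; omega) ?_)
    simp only [Expr.eval, hi', hLi]
    refine WP.seq (WP.countOpp (v := L[i]) hW hβ ho (hM'.congr ?_ ?_) (hS'.congr ?_ ?_) ?_ hLn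
      ?_ ?_)
    · simp [State.setReg]
    · simp [State.setReg]
    · rcases ho with rfl | rfl <;> simp [State.setReg]
    · simp [State.setReg]
    · simp [State.setReg]
    · simp [State.setReg]
    intro s2 t2 hs2 h8 ht2
    have h7 : s2.reg 7 = L[i] := (hs2.1 7 (by decide)).trans (by simp [State.setReg])
    have hM2 : Mat n H s2 := hM'.congr ((hs2.1 0 (by decide)).trans (by simp [State.setReg]))
      (hs2.2 1 (by simp))
    have hx2 : s2.reg 2 = x := (hs2.1 2 (by decide)).trans (by simpa [State.setReg] using hx')
    have hcl : oppCount H β L' L[i] ≤ n := oppCount_le.trans hlen'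
    obtain ⟨hf, he⟩ := codeE_spec (c := .reg 8) hM2 hW hβ hx2 hxn
      (by simp only [Expr.Fits]; omega) (by simp only [Expr.eval]; omega)
    refine WP.write (by simp only [Expr.Fits]; omega) hf ⟨?_, ?_⟩
    · intro v
      have h2 : s2.arr 2 = s'.arr 2 := hs2.2 2 (by simp)
      simp only [State.setReg, State.setArr, Function.update_self, he, Expr.eval, h8, h7, h2]
      have hmem : v ∈ L.take (i + 1) ↔ v ∈ L.take i ∨ v = L[i] := by
        rw [← List.take_append_getElem hi, List.mem_append, List.mem_singleton]
      by_cases hv : v = L[i]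
      · subst hv
        simp [hmem]
      · simp [hmem, hv, hc v]
    · simp only [Expr.cost, codeE]
      omega
  · rintro s' t hs ⟨hc, ht⟩
    rw [List.take_length] at hc
    exact hQ s' _ (hs.mono (by simp) (by simp)) hc (by simp only [Expr.cost]; omega)

end WordRAM

/-! ### Sorting a side by counts -/

/-- The entries of `L` with a value of `f` less than `b`, sorted by the value. -/
def bucketSort (f : ℕ → ℕ) (L : List ℕ) (b : ℕ) : List ℕ :=
  (List.range b).flatMap (fun c => L.filter (fun v => f v = c))

theorem mem_bucketSort {f : ℕ → ℕ} {L : List ℕ} {b v : ℕ} :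
    v ∈ bucketSort f L b ↔ v ∈ L ∧ f v < b := by
  simp only [bucketSort, List.mem_flatMap, List.mem_range, List.mem_filter, decide_eq_true_eq]
  constructor
  · rintro ⟨c, hc, hv, rfl⟩
    exact ⟨hv, hc⟩
  · rintro ⟨hv, hb⟩
    exact ⟨_, hb, hv, rfl⟩

theorem bucketSort_succ {f : ℕ → ℕ} {L : List ℕ} {b : ℕ} :
    bucketSort f L (b + 1) = bucketSort f L b ++ L.filter (fun v => f v = b) := by
  simp [bucketSort, List.range_succ]

theorem pairwise_bucketSort (f : ℕ → ℕ) (L : List ℕ) (b : ℕ) :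
    (bucketSort f L b).Pairwise (fun u v => f u ≤ f v) := by
  induction b with
  | zero => simp [bucketSort]
  | succ b ih =>
    rw [bucketSort_succ, List.pairwise_append]
    refine ⟨ih, ?_, ?_⟩
    · rw [List.pairwise_filter]
      refine List.pairwise_of_forall ?_
      intro u v hu hv
      simp only [decide_eq_true_eq] at hu hv
      omega
    · intro u hu v hv
      have := mem_bucketSort.1 hu
      simp only [List.mem_filter, decide_eq_true_eq] at hv
      omega

theorem nodup_bucketSort {f : ℕ → ℕ} {L : List ℕ} (hL : L.Nodup) (b : ℕ) :
    (bucketSort f L b).Nodup := by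
  induction b with
  | zero => simp [bucketSort]
  | succ b ih =>
    rw [bucketSort_succ, List.nodup_append]
    refine ⟨ih, hL.filter _, ?_⟩
    intro u hu v hv
    have := mem_bucketSort.1 hu
    simp only [List.mem_filter, decide_eq_true_eq] at hv
    rintro rfl
    omega

theorem length_bucketSort_le {f : ℕ → ℕ} {L : List ℕ} (hL : L.Nodup) (b : ℕ) :
    (bucketSort f L b).length ≤ L.length :=
  (List.subperm_of_subset (nodup_bucketSort hL b) fun _ hv => (mem_bucketSort.1 hv).1).length_le

theorem length_bucketSort {f : ℕ → ℕ} {L : List ℕ} (hL : L.Nodup) {b : ℕ} (hb : ∀ v ∈ L, f v < b) :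
    (bucketSort f L b).length = L.length :=
  (length_bucketSort_le hL b).antisymm
    (List.subperm_of_subset hL fun v hv => mem_bucketSort.2 ⟨hv, hb v hv⟩).length_le

/-- The number of the pairs `(v, u)` with `v` from `O`, `u` from `L` and `f u < f v`. -/
def crossPairs (f : ℕ → ℕ) (L O : List ℕ) : ℕ :=
  (O.map fun v => (bucketSort f L (f v)).length).sum

theorem crossPairs_append {f : ℕ → ℕ} {L O O' : List ℕ} :
    crossPairs f L (O ++ O') = crossPairs f L O + crossPairs f L O' := by
  simp [crossPairs]

namespace WordRAM

variable {W n : ℕ} {s : State} {Q : State → ℕ → Prop} {H : SimpleGraph ℕ}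

/-- Sorts the vertices of the list `a`, which are on the side `β` of the pivot in register `2`, by
their counts, into the array `5`. The flag is cleared if vertices with different counts violate the
adjacency that is usual on this side. -/
def Program.sortSide (β a o : ℕ) : Program :=
  .seq (.assign 10 (.const 0)) (.forLoop 9 (.bin .add (.reg o) (.const 1))
    (.seq (.assign 11 (.reg 10)) (.forLoop 5 (.reg a) (.seq (.assign 7 (.read a (.reg 5)))
      (.ite (.bin .eq (.read 2 (.reg 7)) (codeE β (.reg 9)))
        (.seq (.checkAll 6 (.reg 11) (oppE β (.reg 7) (.read 5 (.reg 6))))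
          (.seq (.write 5 (.reg 10) (.reg 7)) (.assign 10 (.bin .add (.reg 10) (.const 1)))))
        .skip)))))

/-- The invariant of the sorting loops: `O` is the list of the vertices that are already sorted. -/
def SortInv (H : SimpleGraph ℕ) (β : ℕ) (L L' : List ℕ) (P : Prop) (O : List ℕ)
    (s : State) : Prop :=
  Holds s 5 O ∧ s.reg 10 = O.length ∧
    Flag s (P ∧ ∀ v ∈ O, ∀ u ∈ bucketSort (oppCount H β L') L (oppCount H β L' v), ¬ Opp H β v u)

theorem SortInv.congr {β : ℕ} {L L' O : List ℕ} {P : Prop} {s' : State}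
    (h : SortInv H β L L' P O s) (h10 : s'.reg 10 = s.reg 10) (h1 : s'.reg 1 = s.reg 1)
    (h5 : s'.arr 5 = s.arr 5) : SortInv H β L L' P O s' :=
  ⟨h.1.congr h5, h10.trans h.2.1, h.2.2.congr h1 Iff.rfl⟩

/-- One round of the inner sorting loop, for the value `b`. -/
theorem WP.sortStep {β a x b i : ℕ} {L L' O : List ℕ} {P : Prop}
    (hW : 2 * (n * n) + 8 * n + 8 ≤ W)
    (hβ : β < 2) (ha : a = 3 ∨ a = 4) (hM : Mat n H s)
    (hL : Stored n s a L) (hx : s.reg 2 = x) (hxn : x < n)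
    (hlab : ∀ v ∈ L, s.arr 2 v = code n x β (oppCount H β L' v))
    (hb : b ≤ n) (h9 : s.reg 9 = b) (hi : i < L.length) (h5 : s.reg 5 = i)
    (h11 : s.reg 11 = (bucketSort (oppCount H β L') L b).length)
    (hinv : SortInv H β L L' P (bucketSort (oppCount H β L') L b ++ O) s)
    (hO : (bucketSort (oppCount H β L') L b ++ O).length ≤ n)
    (hlabW : ∀ v ∈ L, oppCount H β L' v ≤ n)
    (hQ : ∀ s' t, SortInv H β L L' P (bucketSort (oppCount H β L') L b ++
        (O ++ [L[i]].filter (fun v => oppCount H β L' v = b))) s' →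
      t ≤ 60 + 60 * crossPairs (oppCount H β L') L
        ([L[i]].filter (fun v => oppCount H β L' v = b)) → Q s' t) :
    WP W (.seq (.assign 7 (.read a (.reg 5)))
      (.ite (.bin .eq (.read 2 (.reg 7)) (codeE β (.reg 9)))
        (.seq (.checkAll 6 (.reg 11) (oppE β (.reg 7) (.read 5 (.reg 6))))
          (.seq (.write 5 (.reg 10) (.reg 7)) (.assign 10 (.bin .add (.reg 10) (.const 1)))))
        .skip)) Q s := by
  have hlen := hL.length_le
  have hLi : s.arr a i = L[i] := hL.holds i hi
  have hmem : L[i] ∈ L := List.getElem_mem hi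
  have hLn : L[i] < n := hL.lt _ hmem
  have hcn := hlabW _ hmem
  have hl := hlab _ hmem
  refine WP.seq (WP.assign (by simp only [Expr.Fits, Expr.eval, h5, hLi]; omega) ?_)
  simp only [Expr.eval, h5, hLi]
  set s1 := s.setReg 7 L[i] with hs1
  have r1 : ∀ r, r ≠ 7 → s1.reg r = s.reg r := by
    intro r hr
    simp [hs1, State.setReg, hr]
  have a1 : ∀ k, s1.arr k = s.arr k := fun _ => rfl
  have r7 : s1.reg 7 = L[i] := by simp [hs1, State.setReg]
  have hM1 : Mat n H s1 := hM.congr (r1 0 (by decide)) rfl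
  have hinv1 := hinv.congr (s' := s1) (r1 10 (by decide)) (r1 1 (by decide)) rfl
  have hclt := code_lt (n := n) (x := x) hβ hcn
  have hxx : (x + 2) * (n + 1) ≤ n * n + 2 * n + 1 :=
    calc (x + 2) * (n + 1) ≤ (n + 1) * (n + 1) := Nat.mul_le_mul_right _ (by omega)
      _ = n * n + 2 * n + 1 := by ring
  obtain ⟨hf, he⟩ := codeE_spec (c := .reg 9) hM1 hW hβ ((r1 2 (by decide)).trans hx) hxn
    (by simp only [Expr.Fits, r1 9 (by decide), h9]; omega)
    (by simp only [Expr.eval, r1 9 (by decide), h9]; exact hb)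
  refine WP.ite ⟨⟨by simp only [Expr.Fits, r7]; omega,
    by simp only [Expr.eval, r7, a1, hl]; omega⟩, hf,
    by simp only [BinOp.apply]; split_ifs <;> omega⟩ (fun h => ?_) (fun h => ?_)
  · have hib : oppCount H β L' L[i] = b := by
      simp only [Expr.eval, BinOp.apply, he, r7, a1, hl, r1 9 (by decide), h9, code_inj] at h
      simpa using h
    have hmem1 : ∀ v ∈ bucketSort (oppCount H β L') L b, v < n := fun v hv =>
      hL.lt v (mem_bucketSort.1 hv).1
    have hB5 : Holds s1 5 (bucketSort (oppCount H β L') L b) := by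
      intro j hj
      rw [hinv1.1 j (by simp; omega), List.getElem_append_left hj]
    have hfil : [L[i]].filter (fun v => oppCount H β L' v = b) = [L[i]] := by simp [hib]
    rw [hfil] at hQ
    refine WP.seq (WP.checkAll (N := (bucketSort (oppCount H β L') L b).length)
      (good := fun j => ¬ Opp H β L[i] (s1.arr 5 j)) ?_ (by omega) (by decide) hinv1.2.2 ?_ ?_ ?_)
    · rw [List.length_append] at hO
      omega
    · intro s' hs
      have h1 : s'.reg 11 = _ := (hs.1 11 (by decide)).trans ((r1 11 (by decide)).trans h11)
      rw [List.length_append] at hO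
      simp only [Expr.Fits, Expr.eval, h1, and_true]
      omega
    · intro s' hs hj
      have hM' : Mat n H s' := hM1.congr (hs.1 0 (by decide)) (hs.2 1 (by decide))
      have h7 : s'.reg 7 = L[i] := (hs.1 7 (by decide)).trans r7
      have h5' : s'.arr 5 = s1.arr 5 := hs.2 5 (by decide)
      have hjn := hmem1 _ (hB5.mem hj)
      have hB := length_bucketSort_le (f := oppCount H β L') hL.nodup b
      obtain ⟨hf, he⟩ := oppE_spec (β := β) (u := .reg 7) (v := .read 5 (.reg 6)) hM' hW hβ
        (by simp only [Expr.Fits]; omega) (by simp only [Expr.Fits, Expr.eval, h5']; omega)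
        (by simp only [Expr.eval]; omega) (by simp only [Expr.eval, h5']; omega)
      simp only [Expr.eval, h5', h7] at he
      refine ⟨hf, ?_⟩
      rcases he with ⟨he, he'⟩ | ⟨he, he'⟩ <;> simp [he, he']
    · intro s2 t2 hs2 hF2 ht2
      rw [hB5.forall_iff (p := fun w => ¬ Opp H β L[i] w)] at hF2
      have h10 : s2.reg 10 = (bucketSort (oppCount H β L') L b ++ O).length :=
        (hs2.1 10 (by decide)).trans hinv1.2.1
      have h7 : s2.reg 7 = L[i] := (hs2.1 7 (by decide)).trans r7
      refine WP.seq (WP.write (by simp only [Expr.Fits]; omega)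
        (by simp only [Expr.Fits]; omega) ?_)
      refine WP.assign ⟨by simp only [Expr.Fits, State.setArr]; omega,
        by simp only [Expr.Fits]; omega,
        by simp only [Expr.eval, BinOp.apply, State.setArr]; omega⟩ (hQ _ _ ⟨?_, ?_, ?_⟩ ?_)
      · have := (hinv1.1.congr (hs2.2 5 (by decide))).append L[i]
        rw [List.append_assoc] at this
        refine Holds.congr (s := s2.setArr 5 _ L[i]) this ?_
        simp only [Expr.eval, h10, h7]
        rfl
      · simp only [State.setReg, State.setArr, Expr.eval, BinOp.apply, h10, Function.update_self]
        simp
        omega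
      · refine hF2.congr (by simp [State.setReg, State.setArr]) ?_
        rw [← List.append_assoc]
        simp only [List.mem_append, List.mem_singleton, or_imp, forall_and, forall_eq, hib]
        tauto
      · simp only [Expr.cost, oppE, sameE, codeE, crossPairs, hib, List.map_singleton,
          List.sum_singleton] at ht2 ⊢
        omega
  · have hib : oppCount H β L' L[i] ≠ b := by
      simp only [Expr.eval, BinOp.apply, he, r7, a1, hl, r1 9 (by decide), h9, code_inj] at h
      simpa using h
    have hfil : [L[i]].filter (fun v => oppCount H β L' v = b) = [] := by simp [hib]
    rw [hfil] at hQ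
    refine WP.skip (hQ _ _ ?_ ?_)
    · simpa using hinv1
    · simp only [Expr.cost, codeE]
      omega

/-- The time of `sortSide` beyond the rounds of its two outer loops is proportional to the number of
the pairs with different counts. -/
theorem WP.sortSide {β a o x : ℕ} {L L' : List ℕ} {P : Prop} (hW : 2 * (n * n) + 8 * n + 8 ≤ W)
    (hβ : β < 2) (ha : a = 3 ∨ a = 4) (ho : o = 3 ∨ o = 4) (hM : Mat n H s)
    (hL : Stored n s a L) (hL' : Stored n s o L') (hx : s.reg 2 = x) (hxn : x < n)
    (hlab : ∀ v ∈ L, s.arr 2 v = code n x β (oppCount H β L' v)) (hF : Flag s P)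
    (hQ : ∀ s' t, Agree [1, 5, 6, 7, 9, 10, 11] [5] s s' →
      SortInv H β L L' P (bucketSort (oppCount H β L') L (L'.length + 1)) s' →
      t ≤ (L'.length + 1) * (L.length * 80 + 50) + 60 * crossPairs (oppCount H β L') L
        (bucketSort (oppCount H β L') L (L'.length + 1)) + 50 → Q s' t) :
    WP W (.sortSide β a o) Q s := by
  have hlen := hL.length_le
  have hlen' := hL'.length_le
  refine WP.seq (WP.assign (by simp only [Expr.Fits]; omega) ?_)
  refine WP.forLoop (N := L'.length + 1) (fun b s' t =>
    SortInv H β L L' P (bucketSort (oppCount H β L') L b) s' ∧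
    t ≤ b * (L.length * 80 + 50) + 60 * crossPairs (oppCount H β L') L
        (bucketSort (oppCount H β L') L b) + 10) [11, 5, 7, 6, 1, 6, 10, 5] [5] rfl rfl
    (by omega) (by omega) (by decide) ?_ ?_ ?_ ?_
  · intro s' hs
    have h1 := (hs.1 o (by simp; omega)).trans ((show _ = s.reg o by
      rcases ho with rfl | rfl <;> simp [State.setReg]).trans hL'.len)
    simp only [Expr.Fits, Expr.eval, h1, BinOp.apply, and_true]
    omega
  · refine ⟨⟨fun i hi => absurd hi (by simp [bucketSort]), ?_, hF.congr ?_ ?_⟩, ?_⟩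
    · simp [State.setReg, bucketSort, Expr.eval]
    · simp [State.setReg]
    · simp [bucketSort]
    · omega
  · rintro b hb s' t hs hb' ⟨hinv, ht⟩
    have hs0 : Agree [10, 9, 11, 5, 7, 6, 1, 6, 10, 5] [5] s s' :=
      ((Agree.refl _ _ s).setReg (by decide) _).trans (hs.mono (by decide) (by decide))
    have hB := length_bucketSort_le (f := oppCount H β L') hL.nodup b
    have h10 : s'.reg 10 = (bucketSort (oppCount H β L') L b).length := hinv.2.1
    refine WP.seq (WP.assign (by simp only [Expr.Fits]; omega) ?_)
    have hs1 : Agree [10, 9, 11, 5, 7, 6, 1, 6, 10, 5] [5] s (s'.setReg 11 (s'.reg 10)) :=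
      hs0.setReg (by decide) _
    have hinv1 : SortInv H β L L' P _ (s'.setReg 11 (s'.reg 10)) := hinv.congr rfl rfl rfl
    have h91 : (s'.setReg 11 (s'.reg 10)).reg 9 = b := hb'
    have h111 : (s'.setReg 11 (s'.reg 10)).reg 11 =
      (bucketSort (oppCount H β L') L b).length := h10
    simp only [Expr.eval]
    generalize s'.setReg 11 (s'.reg 10) = s1 at *
    refine WP.forLoop (N := L.length) (fun i s' t =>
      SortInv H β L L' P (bucketSort (oppCount H β L') L b ++
        (L.take i).filter (fun v => oppCount H β L' v = b)) s' ∧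
      t ≤ i * 80 + 60 * crossPairs (oppCount H β L') L
        ((L.take i).filter (fun v => oppCount H β L' v = b)) + 10) [7, 6, 1, 6, 10] [5] rfl rfl
      (by omega) (by omega) (by decide) ?_ ?_ ?_ ?_
    · intro s2 hs2
      have h1 := (hs2.1 a (by simp; omega)).trans ((hs1.1 a (by simp; omega)).trans hL.len)
      simp only [Expr.Fits, Expr.eval, h1, and_true]
      omega
    · refine ⟨?_, by omega⟩
      simpa using hinv1.congr (by simp [State.setReg]) (by simp [State.setReg])
        (by simp [State.setReg])
    · rintro i hi s2 t2 hs2 hi2 ⟨hinv2, ht2⟩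
      have hs3 : Agree [10, 9, 11, 5, 7, 6, 1, 6, 10, 5] [5] s s2 :=
        hs1.trans (hs2.mono (by decide) (by decide))
      have h2 : s2.arr 2 = s.arr 2 := hs3.2 2 (by decide)
      refine WP.sortStep (O := (L.take i).filter (fun v => oppCount H β L' v = b)) hW hβ ha
        (hM.congr (hs3.1 0 (by decide)) (hs3.2 1 (by decide)))
        (hL.congr (hs3.1 a (by simp; omega)) (hs3.2 a (by simp; omega)))
        ((hs3.1 2 (by decide)).trans hx) hxn (by rwa [h2]) (by omega)
        ((hs2.1 9 (by decide)).trans h91) hi hi2 ((hs2.1 11 (by decide)).trans h111) hinv2 ?_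
        (fun v _ => oppCount_le.trans hlen') ?_
      · refine le_trans ?_ ((length_bucketSort_le (f := oppCount H β L') hL.nodup (b + 1)).trans
          hlen)
        rw [bucketSort_succ, List.length_append, List.length_append]
        have := ((List.take_sublist i L).filter (fun v => oppCount H β L' v = b)).length_le
        omega
      · intro s4 t4 hinv4 ht4
        rw [← List.take_append_getElem hi, List.filter_append, crossPairs_append]
        refine ⟨hinv4.congr rfl rfl rfl, ?_⟩
        simp only [Expr.cost]
        omega
    · rintro s2 t2 hs2 ⟨hinv2, ht2⟩
      rw [List.take_length] at hinv2 ht2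
      have ht' : (b + 1) * (L.length * 80 + 50) = b * (L.length * 80 + 50) +
        (L.length * 80 + 50) := Nat.succ_mul _ _
      rw [bucketSort_succ, crossPairs_append]
      refine ⟨hinv2.congr rfl rfl rfl, ?_⟩
      simp only [Expr.cost]
      omega
  · rintro s' t hs ⟨hinv, ht⟩
    refine hQ s' _ (Agree.trans ((Agree.refl _ _ s).setReg (by decide) _)
      (hs.mono (by decide) (by decide))) hinv ?_
    simp only [Expr.cost]
    omega

/-- Clears the flag if, for consecutive vertices of the sorted list in array `5`, an exceptional
neighbour in the list `o` of the first one is not an exceptional neighbour of the second one. In the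
first round, where the truncated index `0 - 1` is `0`, a vertex is compared with itself. -/
def Program.checkChain (β a o : ℕ) : Program :=
  .forLoop 5 (.reg a) (.checkAll 6 (.reg o) (.bin .lt
    (sameE β (.read 5 (.bin .sub (.reg 5) (.const 1))) (.read o (.reg 6)))
    (sameE β (.read 5 (.reg 5)) (.read o (.reg 6)))))

theorem WP.checkChain {β a o : ℕ} {L L' O : List ℕ} {P : Prop}
    (hW : 2 * (n * n) + 8 * n + 8 ≤ W)
    (hβ : β < 2) (ha : a = 3 ∨ a = 4) (ho : o = 3 ∨ o = 4) (hM : Mat n H s)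
    (hL : Stored n s a L) (hL' : Stored n s o L') (hO : Holds s 5 O) (hOn : ∀ v ∈ O, v < n)
    (hOL : O.length = L.length) (hF : Flag s P)
    (hQ : ∀ s' t, Agree [1, 5, 6] [] s s' →
      Flag s' (P ∧ ∀ i < L.length, ∀ w ∈ L', Opp H β (s.arr 5 (i - 1)) w →
        Opp H β (s.arr 5 i) w) →
      t ≤ L.length * (L'.length * 60 + 50) + 10 → Q s' t) :
    WP W (.checkChain β a o) Q s := by
  have hlen := hL.length_le
  have hlen' := hL'.length_le
  refine WP.forLoop (N := L.length) (fun i s' t =>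
    Flag s' (P ∧ ∀ i' < i, ∀ w ∈ L', Opp H β (s.arr 5 (i' - 1)) w → Opp H β (s.arr 5 i') w) ∧
    t ≤ i * (L'.length * 60 + 50) + 2) [6, 1, 6] [] rfl rfl
    (by omega) (by omega) (by decide) ?_ ?_ ?_ ?_
  · intro s' hs
    have h1 := (hs.1 a (by simp; omega)).trans hL.len
    simp only [Expr.Fits, Expr.eval, h1, and_true]
    omega
  · exact ⟨hF.congr (by simp [State.setReg]) (by simp), by omega⟩
  · rintro i hi s' t hs hi' ⟨hFi, ht⟩
    have hS' : Stored n s' o L' := hL'.congr (hs.1 o (by simp; omega)) (hs.2 o (by simp))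
    have ht' : (i + 1) * (L'.length * 60 + 50) = i * (L'.length * 60 + 50) +
      (L'.length * 60 + 50) := Nat.succ_mul _ _
    refine WP.checkAll (N := L'.length) (good := fun j => Opp H β (s.arr 5 (i - 1)) (s'.arr o j) →
      Opp H β (s.arr 5 i) (s'.arr o j)) (by omega) (by omega) (by decide) hFi ?_ ?_ ?_
    · intro s2 hs2
      have h1 := (hs2.1 o (by simp; omega)).trans hS'.len
      simp only [Expr.Fits, Expr.eval, h1, and_true]
      omega
    · intro s2 hs2 hj
      have hs3 : Agree [6, 1, 5] [] s s2 :=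
        (hs.mono (by decide) (by decide)).trans (hs2.mono (by decide) (by decide))
      have hM' : Mat n H s2 := hM.congr (hs3.1 0 (by decide)) (hs3.2 1 (by decide))
      have h5 : s2.reg 5 = i := (hs2.1 5 (by decide)).trans hi'
      have a5 : s2.arr 5 = s.arr 5 := hs3.2 5 (by decide)
      have ao : s2.arr o = s'.arr o := hs2.2 o (by simp)
      have hu := hOn _ (hO.mem (i := i - 1) (by omega))
      have hv := hOn _ (hO.mem (i := i) (by omega))
      have hw := hS'.lt _ (hS'.holds.mem hj)
      have hwf : (Expr.read o (.reg 6)).Fits W s2 := by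
        simp only [Expr.Fits, Expr.eval, ao]
        omega
      have hwn : (Expr.read o (.reg 6)).eval s2 < n := by
        simp only [Expr.eval, ao]
        omega
      obtain ⟨hf1, he1⟩ := sameE_spec (β := β) (u := .read 5 (.bin .sub (.reg 5) (.const 1)))
        (v := .read o (.reg 6)) hM' hW hβ
        (by simp only [Expr.Fits, Expr.eval, BinOp.apply, h5, a5]; omega) hwf
        (by simp only [Expr.eval, BinOp.apply, h5, a5]; omega) hwn
      obtain ⟨hf2, he2⟩ := sameE_spec (β := β) (u := .read 5 (.reg 5))
        (v := .read o (.reg 6)) hM' hW hβ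
        (by simp only [Expr.Fits, Expr.eval, h5, a5]; omega) hwf
        (by simp only [Expr.eval, h5, a5]; omega) hwn
      simp only [Expr.eval, BinOp.apply, h5, a5, ao] at he1 he2
      refine ⟨⟨hf1, hf2, ?_⟩, ?_⟩
      · simp only [BinOp.apply]
        split_ifs <;> omega
      · simp only [Expr.eval, BinOp.apply]
        rcases he1 with ⟨he1, he1'⟩ | ⟨he1, he1'⟩ <;> rcases he2 with ⟨he2, he2'⟩ | ⟨he2, he2'⟩ <;>
          simp [he1, he1', he2, he2']
    · intro s2 t2 hs2 hF2 ht2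
      rw [hS'.holds.forall_iff (p := fun w => Opp H β (s.arr 5 (i - 1)) w →
        Opp H β (s.arr 5 i) w)] at hF2
      refine ⟨hF2.congr (by simp [State.setReg]) ?_, ?_⟩
      · rw [and_assoc, Nat.forall_lt_succ_right]
      · simp only [Expr.cost, sameE] at ht2 ⊢
        omega
  · rintro s' t hs ⟨hFi, ht⟩
    exact hQ s' _ (hs.mono (by decide) (by decide)) hFi (by simp only [Expr.cost]; omega)

end WordRAM

namespace WordRAM

variable {W n : ℕ} {s : State} {Q : State → ℕ → Prop} {H : SimpleGraph ℕ}

/-! ### Testing a side, and splitting a class into sides -/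

/-- For an array that holds the list `L` sorted by the counts, comparing consecutive entries is
enough: nested neighbourhoods of the same size are equal, so the order within a group does not
matter. -/
theorem sideGood_iff {β : ℕ} {L L' : List ℕ} (hL : L.Nodup)
    (hO : Holds s 5 (bucketSort (oppCount H β L') L (L'.length + 1))) :
    SideGood H β L L' ↔
      (∀ v ∈ bucketSort (oppCount H β L') L (L'.length + 1),
        ∀ u ∈ bucketSort (oppCount H β L') L (oppCount H β L' v), ¬ Opp H β v u) ∧
      ∀ i < L.length, ∀ w ∈ L', Opp H β (s.arr 5 (i - 1)) w → Opp H β (s.arr 5 i) w := by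
  have hf : ∀ v ∈ L, oppCount H β L' v < L'.length + 1 := fun v _ => Nat.lt_succ_of_le oppCount_le
  have hlen := length_bucketSort hL hf
  have hmem : ∀ v, v ∈ bucketSort (oppCount H β L') L (L'.length + 1) ↔ v ∈ L := fun v => by
    rw [mem_bucketSort]
    exact ⟨fun h => h.1, fun h => ⟨h, hf v h⟩⟩
  have hsort : ∀ i j, i ≤ j → j < L.length →
      oppCount H β L' (s.arr 5 i) ≤ oppCount H β L' (s.arr 5 j) := by
    intro i j hij hj
    rcases hij.eq_or_lt with rfl | hij
    · exact le_rfl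
    · rw [hO i (by omega), hO j (by omega)]
      exact List.pairwise_iff_getElem.1 (pairwise_bucketSort _ L _) i j (by omega) (by omega) hij
  have hget : ∀ i < L.length, s.arr 5 i ∈ L := fun i hi => (hmem _).1 (hO.mem (by omega))
  have hex : ∀ v ∈ L, ∃ i < L.length, s.arr 5 i = v := by
    intro v hv
    obtain ⟨i, hi, rfl⟩ := List.mem_iff_getElem.1 ((hmem v).2 hv)
    exact ⟨i, by omega, hO i hi⟩
  refine and_congr ?_ ?_
  · simp only [hmem, mem_bucketSort, Opp, not_not, and_imp]
  · constructor
    · intro h i hi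
      exact h _ (hget _ (by omega)) _ (hget _ hi) (hsort _ _ (by omega) hi)
    · intro h u hu v hv huv w hw
      have chain : ∀ j, j < L.length → ∀ i ≤ j, ∀ w ∈ L',
          Opp H β (s.arr 5 i) w → Opp H β (s.arr 5 j) w := by
        intro j
        induction j with
        | zero =>
          intro _ i hi w hw
          obtain rfl : i = 0 := by omega
          exact id
        | succ j ih =>
          intro hj i hi w hw hopp
          rcases hi.eq_or_lt with rfl | hi
          · exact hopp
          · exact h (j + 1) hj w hw (ih (by omega) i (by omega) w hw hopp)
      obtain ⟨i, hi, rfl⟩ := hex u hu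
      obtain ⟨j, hj, rfl⟩ := hex v hv
      rcases le_or_gt i j with hij | hij
      · exact chain j hj i hij w hw
      · intro h1
        by_contra h2
        have := oppCount_lt (chain i hi j hij.le) hw h1 h2
        omega

/-- Computes the new labels on the side `β` of the pivot in register `2` and tests this side. -/
def Program.side (β a o : ℕ) : Program :=
  .seq (.relabel β a o) (.seq (.sortSide β a o) (.checkChain β a o))

/-- The number of the pairs of vertices on the side `L` of a pivot that are in different groups,
where `L'` is the other side. -/
noncomputable def sidePairs (H : SimpleGraph ℕ) (β : ℕ) (L L' : List ℕ) : ℕ :=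
  crossPairs (oppCount H β L') L (bucketSort (oppCount H β L') L (L'.length + 1))

theorem WP.side {β a o x : ℕ} {L L' : List ℕ} {P : Prop} (hW : 2 * (n * n) + 8 * n + 8 ≤ W)
    (hβ : β < 2) (ha : a = 3 ∨ a = 4) (ho : o = 3 ∨ o = 4) (hM : Mat n H s)
    (hL : Stored n s a L) (hL' : Stored n s o L') (hx : s.reg 2 = x) (hxn : x < n) (hF : Flag s P)
    (hQ : ∀ s' t, Agree [1, 5, 6, 7, 8, 9, 10, 11] [2, 5] s s' →
      (∀ v, s'.arr 2 v = if v ∈ L then code n x β (oppCount H β L' v) else s.arr 2 v) →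
      Flag s' (P ∧ SideGood H β L L') →
      t ≤ 200 * (1 + L.length + L'.length + L.length * L'.length + sidePairs H β L L') → Q s' t) :
    WP W (.side β a o) Q s := by
  refine WP.seq (WP.relabel hW hβ ha ho hM hL hL' hx hxn fun s1 t1 hs1 hlab1 ht1 => ?_)
  have hM1 : Mat n H s1 := hM.congr (hs1.1 0 (by decide)) (hs1.2 1 (by decide))
  have hL1 : Stored n s1 a L := hL.congr (hs1.1 a (by simp; omega)) (hs1.2 a (by simp; omega))
  have hL1' : Stored n s1 o L' := hL'.congr (hs1.1 o (by simp; omega)) (hs1.2 o (by simp; omega))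
  refine WP.seq (WP.sortSide hW hβ ha ho hM1 hL1 hL1' ((hs1.1 2 (by decide)).trans hx) hxn
    (fun v hv => by rw [hlab1, if_pos hv]) (hF.congr (hs1.1 1 (by decide)) Iff.rfl)
    fun s2 t2 hs2 hinv2 ht2 => ?_)
  have hM2 : Mat n H s2 := hM1.congr (hs2.1 0 (by decide)) (hs2.2 1 (by decide))
  have hL2 : Stored n s2 a L := hL1.congr (hs2.1 a (by simp; omega)) (hs2.2 a (by simp; omega))
  have hL2' : Stored n s2 o L' := hL1'.congr (hs2.1 o (by simp; omega)) (hs2.2 o (by simp; omega))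
  refine WP.checkChain hW hβ ha ho hM2 hL2 hL2' hinv2.1
    (fun v hv => hL.lt v (mem_bucketSort.1 hv).1)
    (length_bucketSort hL.nodup fun v _ => Nat.lt_succ_of_le oppCount_le) hinv2.2.2
    fun s3 t3 hs3 hF3 ht3 => hQ s3 _ ?_ ?_ ?_ ?_
  · exact ((hs1.mono (by decide) (by decide)).trans (hs2.mono (by decide) (by decide))).trans
      (hs3.mono (by decide) (by decide))
  · rw [hs3.2 2 (by decide), hs2.2 2 (by decide)]
    exact hlab1
  · refine hF3.congr rfl ?_
    rw [and_assoc, sideGood_iff hL.nodup hinv2.1]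
  · have e1 : (L'.length + 1) * (L.length * 80 + 50) =
      80 * (L.length * L'.length) + 80 * L.length + 50 * L'.length + 50 := by ring
    have e2 : L.length * (L'.length * 60 + 50) =
      60 * (L.length * L'.length) + 50 * L.length := by ring
    have e3 : L.length * (L'.length * 30 + 50) =
      30 * (L.length * L'.length) + 50 * L.length := by ring
    simp only [sidePairs]
    omega

open Classical in
/-- The vertices other than the pivot `x` with the same label as `x`, on its side `β`: the
non-neighbours of `x` for `β = 0`, the neighbours for `β = 1`. -/
noncomputable def sideList (H : SimpleGraph ℕ) (lab : ℕ → ℕ) (x β n : ℕ) : List ℕ :=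
  (List.range n).filter fun v => v ≠ x ∧ lab v = lab x ∧ (H.Adj x v ↔ β = 1)

theorem mem_sideList {lab : ℕ → ℕ} {x β v : ℕ} :
    v ∈ sideList H lab x β n ↔ v < n ∧ v ≠ x ∧ lab v = lab x ∧ (H.Adj x v ↔ β = 1) := by
  simp [sideList]

theorem nodup_sideList {lab : ℕ → ℕ} {x β : ℕ} : (sideList H lab x β n).Nodup :=
  List.nodup_range.filter _

open Classical in
theorem sideList_succ {lab : ℕ → ℕ} {x β v : ℕ} : sideList H lab x β (v + 1) =
    sideList H lab x β v ++
      if v ≠ x ∧ lab v = lab x ∧ (H.Adj x v ↔ β = 1) then [v] else [] := by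
  simp only [sideList, List.range_succ, List.filter_append]
  congr 1
  split_ifs with h
  · simpa using h
  · simpa using h

/-- Collects the vertices with the same label as the pivot in register `2`, the non-neighbours of
the pivot in the list `3` and the neighbours in the list `4`. -/
def Program.splitClass : Program :=
  .seq (.assign 3 (.const 0)) (.seq (.assign 4 (.const 0)) (.forLoop 7 (.reg 0)
    (.ite (.bin .lt (.bin .eq (.reg 7) (.reg 2)) (.bin .eq (.read 2 (.reg 7)) (.read 2 (.reg 2))))
      (.ite (sameE 1 (.reg 2) (.reg 7))
        (.seq (.write 4 (.reg 4) (.reg 7)) (.assign 4 (.bin .add (.reg 4) (.const 1))))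
        (.seq (.write 3 (.reg 3) (.reg 7)) (.assign 3 (.bin .add (.reg 3) (.const 1)))))
      .skip)))

theorem WP.splitClass {x : ℕ} (hW : 2 * (n * n) + 8 * n + 8 ≤ W) (hM : Mat n H s)
    (hx : s.reg 2 = x) (hxn : x < n) (hlab : ∀ v < n, s.arr 2 v < W)
    (hQ : ∀ s' t, Agree [3, 4, 7] [3, 4] s s' →
      Stored n s' 3 (sideList H (s.arr 2) x 0 n) → Stored n s' 4 (sideList H (s.arr 2) x 1 n) →
      t ≤ 60 * n + 20 → Q s' t) :
    WP W .splitClass Q s := by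
  refine WP.seq (WP.assign (by simp only [Expr.Fits]; omega) ?_)
  refine WP.seq (WP.assign (by simp only [Expr.Fits]; omega) ?_)
  have hs0 : Agree [3, 4, 7] [3, 4] s ((s.setReg 3 0).setReg 4 0) :=
    ((Agree.refl _ _ _).setReg (by decide) _).setReg (by decide) _
  have h3 : ((s.setReg 3 0).setReg 4 0).reg 3 = 0 := by simp [State.setReg]
  have h4 : ((s.setReg 3 0).setReg 4 0).reg 4 = 0 := by simp [State.setReg]
  simp only [Expr.eval]
  generalize (s.setReg 3 0).setReg 4 0 = s0 at *
  have len : ∀ β v, (sideList H (s.arr 2) x β v).length ≤ v := fun β v =>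
    length_le_of_nodup_of_lt nodup_sideList fun u hu => (mem_sideList.1 hu).1
  refine WP.forLoop (N := n) (fun v s' t =>
    (s'.reg 3 = (sideList H (s.arr 2) x 0 v).length ∧ Holds s' 3 (sideList H (s.arr 2) x 0 v)) ∧
    (s'.reg 4 = (sideList H (s.arr 2) x 1 v).length ∧ Holds s' 4 (sideList H (s.arr 2) x 1 v)) ∧
    t ≤ 60 * v + 2) [4, 3] [4, 3] rfl rfl (by omega) (by omega) (by decide) ?_ ?_ ?_ ?_
  · intro s' hs
    have h0 : s'.reg 0 = n := (hs.1 0 (by decide)).trans ((hs0.1 0 (by decide)).trans hM.reg)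
    simp only [Expr.Fits, Expr.eval, h0, and_true]
    omega
  · refine ⟨⟨?_, fun i hi => absurd hi (by simp [sideList])⟩,
      ⟨?_, fun i hi => absurd hi (by simp [sideList])⟩, by omega⟩
    · simp [State.setReg, sideList, h3]
    · simp [State.setReg, sideList, h4]
  · rintro v hv s' t hs h7 ⟨⟨h3, hH3⟩, ⟨h4, hH4⟩, ht⟩
    have hs' : Agree [3, 4, 7] [3, 4] s s' := hs0.trans (hs.mono (by decide) (by decide))
    have hM' : Mat n H s' := hM.congr (hs'.1 0 (by decide)) (hs'.2 1 (by decide))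
    have h2 : s'.reg 2 = x := (hs'.1 2 (by decide)).trans hx
    have a2 : s'.arr 2 = s.arr 2 := hs'.2 2 (by decide)
    have l0 := len 0 v
    have l1 := len 1 v
    have hlv := hlab v hv
    have hlx := hlab x hxn
    have e0 := sideList_succ (H := H) (lab := s.arr 2) (x := x) (β := 0) (v := v)
    have e1 := sideList_succ (H := H) (lab := s.arr 2) (x := x) (β := 1) (v := v)
    obtain ⟨hf, he⟩ := sameE_spec (β := 1) (u := .reg 2) (v := .reg 7) hM' hW (by omega)
      (by simp only [Expr.Fits]; omega) (by simp only [Expr.Fits]; omega)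
      (by simp only [Expr.eval]; omega) (by simp only [Expr.eval]; omega)
    simp only [Expr.eval, h2, h7, Opp, iff_true, not_not] at he
    refine WP.ite ?_ (fun h => ?_) (fun h => ?_)
    · simp only [Expr.Fits, Expr.eval, BinOp.apply, h7, h2, a2]
      split_ifs <;> omega
    · have hvx : v ≠ x ∧ s.arr 2 v = s.arr 2 x := by
        simp only [Expr.eval, BinOp.apply, h7, h2, a2] at h
        split_ifs at h <;> simp_all
      refine WP.ite hf (fun h' => ?_) (fun h' => ?_)
      · have hadj : H.Adj x v := by
          rcases he with he | he
          · exact he.2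
          · exact absurd he.1 h'
        simp [hvx, hadj] at e0 e1
        refine WP.seq (WP.write (by simp only [Expr.Fits]; omega) (by simp only [Expr.Fits]; omega)
          (WP.assign (by simp only [Expr.Fits, Expr.eval, BinOp.apply, State.setArr]; omega) ?_))
        rw [e0, e1]
        refine ⟨⟨?_, hH3.congr ?_⟩, ⟨?_, ?_⟩, ?_⟩
        · simpa [State.setReg, State.setArr] using h3
        · simp [State.setReg, State.setArr]
        · simp [State.setReg, State.setArr, Expr.eval, BinOp.apply, h4]
        · refine Holds.congr (hH4.append v) ?_
          simp [State.setReg, State.setArr, Expr.eval, h4, h7]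
        · simp only [Expr.cost, sameE]
          omega
      · have hadj : ¬ H.Adj x v := by
          rcases he with he | he
          · omega
          · exact he.2
        simp [hvx, hadj] at e0 e1
        refine WP.seq (WP.write (by simp only [Expr.Fits]; omega) (by simp only [Expr.Fits]; omega)
          (WP.assign (by simp only [Expr.Fits, Expr.eval, BinOp.apply, State.setArr]; omega) ?_))
        rw [e0, e1]
        refine ⟨⟨?_, ?_⟩, ⟨?_, hH4.congr ?_⟩, ?_⟩
        · simp [State.setReg, State.setArr, Expr.eval, BinOp.apply, h3]
        · refine Holds.congr (hH3.append v) ?_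
          simp [State.setReg, State.setArr, Expr.eval, h3, h7]
        · simpa [State.setReg, State.setArr] using h4
        · simp [State.setReg, State.setArr]
        · simp only [Expr.cost, sameE]
          omega
    · have hvx : ∀ p : Prop, ¬ (v ≠ x ∧ s.arr 2 v = s.arr 2 x ∧ p) := by
        rintro p ⟨h1, h2', -⟩
        simp [Expr.eval, BinOp.apply, h7, h2, a2, h1, h2'] at h
      rw [if_neg (hvx _), List.append_nil] at e0 e1
      rw [e0, e1]
      refine WP.skip ⟨⟨?_, hH3.congr rfl⟩, ⟨?_, hH4.congr rfl⟩, ?_⟩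
      · simpa [State.setReg] using h3
      · simpa [State.setReg] using h4
      · simp only [Expr.cost]
        omega
  · rintro s' t hs ⟨⟨h3, hH3⟩, ⟨h4, hH4⟩, ht⟩
    refine hQ s' _ (hs0.trans (hs.mono (by decide) (by decide)))
      ⟨h3, hH3, fun v hv => (mem_sideList.1 hv).1, nodup_sideList⟩
      ⟨h4, hH4, fun v hv => (mem_sideList.1 hv).1, nodup_sideList⟩ ?_
    simp only [Expr.cost]
    omega

end WordRAM

/-! ### Refinement of the classes -/

namespace WordRAM

variable {W n : ℕ} {s : State} {Q : State → ℕ → Prop} {H : SimpleGraph ℕ}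

/-- All classes of vertices `v < n` with the same label are free of induced paths on four
vertices. -/
def ClassesFree (n : ℕ) (H : SimpleGraph ℕ) (lab : ℕ → ℕ) : Prop :=
  ∀ l, P4FreeOn H {v | v < n ∧ lab v = l}

/-- The labels `lab'` arise from `lab` when the class of the pivot `x` is split into the pivot and
the groups of its two sides. -/
structure Refines (n : ℕ) (H : SimpleGraph ℕ) (x : ℕ) (lab lab' : ℕ → ℕ) : Prop where
  pivot_lt : x < n
  /-- All labels in use are smaller than the new ones. -/
  lab_lt : ∀ v < n, lab v < 2 * ((x + 1) * (n + 1))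
  side0 : ∀ v ∈ sideList H lab x 0 n,
    lab' v = code n x 0 (oppCount H 0 (sideList H lab x 1 n) v)
  side1 : ∀ v ∈ sideList H lab x 1 n,
    lab' v = code n x 1 (oppCount H 1 (sideList H lab x 0 n) v)
  other : ∀ v, v ∉ sideList H lab x 0 n → v ∉ sideList H lab x 1 n → lab' v = lab v

theorem length_sideList_le {lab : ℕ → ℕ} {x β : ℕ} : (sideList H lab x β n).length ≤ n :=
  length_le_of_nodup_of_lt nodup_sideList fun _ hu => (mem_sideList.1 hu).1

theorem Refines.cases {x : ℕ} {lab lab' : ℕ → ℕ} (h : Refines n H x lab lab') (v : ℕ) (hv : v < n) :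
    (v ∈ sideList H lab x 0 n ∧ v ∉ sideList H lab x 1 n ∧ v ≠ x ∧ lab v = lab x ∧
      lab' v = code n x 0 (oppCount H 0 (sideList H lab x 1 n) v)) ∨
    (v ∈ sideList H lab x 1 n ∧ v ∉ sideList H lab x 0 n ∧ v ≠ x ∧ lab v = lab x ∧
      lab' v = code n x 1 (oppCount H 1 (sideList H lab x 0 n) v)) ∨
    (v ∉ sideList H lab x 0 n ∧ v ∉ sideList H lab x 1 n ∧ (v = x ∨ lab v ≠ lab x) ∧
      lab' v = lab v ∧ lab' v < 2 * ((x + 1) * (n + 1))) := by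
  have h0 := h.side0 v
  have h1 := h.side1 v
  have h2 := h.other v
  have hlt := h.lab_lt v hv
  simp only [mem_sideList] at h0 h1 h2 ⊢
  by_cases hx : v = x
  · simp_all
  · by_cases hl : lab v = lab x
    · by_cases ha : H.Adj x v <;> simp_all
    · simp_all

theorem le_code {x β c : ℕ} : 2 * ((x + 1) * (n + 1)) ≤ code n x β c := by
  unfold code
  omega

theorem Refines.lab_eq {x : ℕ} {lab lab' : ℕ → ℕ} (h : Refines n H x lab lab') {u v : ℕ}
    (hu : u < n) (hv : v < n) (huv : lab' u = lab' v) : lab u = lab v := by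
  have hc := fun β c => le_code (n := n) (x := x) (β := β) (c := c)
  rcases h.cases u hu with ⟨-, -, -, h1, h2⟩ | ⟨-, -, -, h1, h2⟩ | ⟨-, -, h3, h1, h2⟩ <;>
    rcases h.cases v hv with ⟨-, -, -, h1', h2'⟩ | ⟨-, -, -, h1', h2'⟩ | ⟨-, -, h3', h1', h2'⟩ <;>
    first
    | omega
    | (have := hc 0 (oppCount H 0 (sideList H lab x 1 n) u)
       have := hc 1 (oppCount H 1 (sideList H lab x 0 n) u)
       have := hc 0 (oppCount H 0 (sideList H lab x 1 n) v)
       have := hc 1 (oppCount H 1 (sideList H lab x 0 n) v)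
       omega)

/-- The pivot is alone in its new class. -/
theorem Refines.lab_pivot {x : ℕ} {lab lab' : ℕ → ℕ} (h : Refines n H x lab lab') {v : ℕ}
    (hv : v < n) (hvx : lab' v = lab' x) : v = x := by
  have hc := fun β c => le_code (n := n) (x := x) (β := β) (c := c)
  have hlab := h.lab_eq hv h.pivot_lt hvx
  rcases h.cases x h.pivot_lt with h' | h' | ⟨-, -, -, -, hx⟩
  · exact absurd rfl h'.2.2.1
  · exact absurd rfl h'.2.2.1
  · rcases h.cases v hv with h' | h' | h'
    · have := hc 0 (oppCount H 0 (sideList H lab x 1 n) v)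
      omega
    · have := hc 1 (oppCount H 1 (sideList H lab x 0 n) v)
      omega
    · exact h'.2.2.1.resolve_right (not_not.2 hlab)

theorem Refines.lab_lt' {x : ℕ} {lab lab' : ℕ → ℕ} (h : Refines n H x lab lab') {v : ℕ}
    (hv : v < n) : lab' v < 2 * ((x + 2) * (n + 1)) := by
  have hlen := fun β => length_sideList_le (H := H) (lab := lab) (x := x) (β := β) (n := n)
  have hxx : (x + 1) * (n + 1) ≤ (x + 2) * (n + 1) := Nat.mul_le_mul_right _ (by omega)
  rcases h.cases v hv with h' | h' | h'
  · rw [h'.2.2.2.2]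
    exact code_lt (by omega) (oppCount_le.trans (hlen 1))
  · rw [h'.2.2.2.2]
    exact code_lt (by omega) (oppCount_le.trans (hlen 0))
  · omega

/-- The tests of a pivot step fail only if the graph is not a cograph, and if they are passed, no
induced path is lost by passing to the smaller classes. -/
theorem Refines.classesFree_iff {x : ℕ} {lab lab' : ℕ → ℕ} (h : Refines n H x lab lab') :
    ClassesFree n H lab ↔
      (SideGood H 0 (sideList H lab x 0 n) (sideList H lab x 1 n) ∧
        SideGood H 1 (sideList H lab x 1 n) (sideList H lab x 0 n)) ∧ ClassesFree n H lab' := by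
  constructor
  · intro hf
    refine ⟨⟨?_, ?_⟩, ?_⟩
    · refine SideGood.of_p4FreeOn (by omega) (x := x) (C := {v | v < n ∧ lab v = lab x})
        ⟨h.pivot_lt, rfl⟩ (fun v hv => ?_) (fun v hv => ?_) (hf _)
      · have := mem_sideList.1 hv
        exact ⟨⟨this.1, this.2.2.1⟩, this.2.1, this.2.2.2⟩
      · have := mem_sideList.1 hv
        exact ⟨⟨this.1, this.2.2.1⟩, this.2.1, by simpa using this.2.2.2⟩
    · refine SideGood.of_p4FreeOn (by omega) (x := x) (C := {v | v < n ∧ lab v = lab x})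
        ⟨h.pivot_lt, rfl⟩ (fun v hv => ?_) (fun v hv => ?_) (hf _)
      · have := mem_sideList.1 hv
        exact ⟨⟨this.1, this.2.2.1⟩, this.2.1, this.2.2.2⟩
      · have := mem_sideList.1 hv
        exact ⟨⟨this.1, this.2.2.1⟩, this.2.1, by simpa using this.2.2.2⟩
    · rintro l a ⟨ha, rfl⟩ b ⟨hb, hb'⟩ c ⟨hc, hc'⟩ d ⟨hd, hd'⟩
      exact hf (lab a) a ⟨ha, rfl⟩ b ⟨hb, h.lab_eq hb ha hb'⟩ c ⟨hc, h.lab_eq hc ha hc'⟩ d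
        ⟨hd, h.lab_eq hd ha hd'⟩
  · rintro ⟨⟨h0, h1⟩, hf⟩ l
    by_cases hl : l = lab x
    · subst hl
      refine p4FreeOn_of_sideGood (x := x) ?_ ?_ ?_ h0 h1 ?_ ?_
      · rintro v ⟨hv, hvx⟩
        rcases h.cases v hv with h' | h' | h'
        · exact Or.inr (Or.inl h'.1)
        · exact Or.inr (Or.inr h'.1)
        · exact Or.inl (h'.2.2.1.resolve_right (not_not.2 hvx))
      · intro v hv
        have := mem_sideList.1 hv
        exact ⟨this.2.1, by simpa using this.2.2.2⟩
      · intro v hv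
        have := mem_sideList.1 hv
        simpa using this.2.2.2
      · intro k
        refine (hf (code n x 0 k)).mono ?_
        rintro v ⟨hv, rfl⟩
        exact ⟨(mem_sideList.1 hv).1, h.side0 v hv⟩
      · intro k
        refine (hf (code n x 1 k)).mono ?_
        rintro v ⟨hv, rfl⟩
        exact ⟨(mem_sideList.1 hv).1, h.side1 v hv⟩
    · refine (hf l).mono ?_
      rintro v ⟨hv, rfl⟩
      refine ⟨hv, h.other v ?_ ?_⟩ <;>
      · rw [mem_sideList]
        tauto

/-- The number of the pairs of vertices with the same label. The running time is bounded by the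
decrease of this potential. -/
def samePairs (n : ℕ) (lab : ℕ → ℕ) : ℕ :=
  ∑ v ∈ Finset.range n, ((Finset.range n).filter fun u => lab u = lab v).card

theorem samePairs_le {lab : ℕ → ℕ} : samePairs n lab ≤ n * n := by
  refine (Finset.sum_le_card_nsmul _ _ n fun v _ => ?_).trans (by simp)
  exact (Finset.card_filter_le _ _).trans (by simp)

/-- The number of the partners from which `v` is separated, counting those on the other side `L'`
and those with a smaller count on the same side `L`. -/
noncomputable def partners (H : SimpleGraph ℕ) (β : ℕ) (L L' : List ℕ) (v : ℕ) : ℕ :=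
  L'.length + (bucketSort (oppCount H β L') L (oppCount H β L' v)).length

theorem sum_partners {β : ℕ} {L L' : List ℕ} (hL : L.Nodup) :
    ∑ v ∈ L.toFinset, partners H β L L' v = L.length * L'.length + sidePairs H β L L' := by
  have hO : (bucketSort (oppCount H β L') L (L'.length + 1)).toFinset = L.toFinset := by
    ext v
    rw [List.mem_toFinset, List.mem_toFinset, mem_bucketSort]
    exact ⟨fun h => h.1, fun h => ⟨h, Nat.lt_succ_of_le oppCount_le⟩⟩
  simp only [partners, Finset.sum_add_distrib, Finset.sum_const, smul_eq_mul, sidePairs, crossPairs]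
  rw [List.toFinset_card_of_nodup hL, ← hO, List.sum_toFinset _ (nodup_bucketSort hL _)]

/-- The potential pays for a pivot step: it decreases at least by the number of the pairs that are
examined, since these pairs lose their common label. -/
theorem Refines.samePairs_le {x : ℕ} {lab lab' : ℕ → ℕ} (h : Refines n H x lab lab') :
    samePairs n lab' +
      ((sideList H lab x 0 n).length * (sideList H lab x 1 n).length +
        sidePairs H 0 (sideList H lab x 0 n) (sideList H lab x 1 n)) +
      ((sideList H lab x 1 n).length * (sideList H lab x 0 n).length +
        sidePairs H 1 (sideList H lab x 1 n) (sideList H lab x 0 n)) ≤ samePairs n lab := by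
  set L0 := sideList H lab x 0 n with hL0
  set L1 := sideList H lab x 1 n with hL1
  have n0 : L0.Nodup := nodup_sideList
  have n1 : L1.Nodup := nodup_sideList
  have sub : ∀ β, (sideList H lab x β n).toFinset ⊆ Finset.range n := by
    intro β v hv
    rw [List.mem_toFinset, mem_sideList] at hv
    exact Finset.mem_range.2 hv.1
  have e0 : ∑ v ∈ L0.toFinset, partners H 0 L0 L1 v =
      ∑ v ∈ Finset.range n, if v ∈ L0.toFinset then partners H 0 L0 L1 v else 0 := by
    rw [Finset.sum_ite_mem, Finset.inter_eq_right.2 (sub 0)]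
  have e1 : ∑ v ∈ L1.toFinset, partners H 1 L1 L0 v =
      ∑ v ∈ Finset.range n, if v ∈ L1.toFinset then partners H 1 L1 L0 v else 0 := by
    rw [Finset.sum_ite_mem, Finset.inter_eq_right.2 (sub 1)]
  rw [← sum_partners n0, ← sum_partners n1, e0, e1, samePairs, samePairs,
    ← Finset.sum_add_distrib, ← Finset.sum_add_distrib]
  refine Finset.sum_le_sum fun v hv => ?_
  rw [Finset.mem_range] at hv
  have hmono : (Finset.range n).filter (fun u => lab' u = lab' v) ⊆
      (Finset.range n).filter (fun u => lab u = lab v) := by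
    intro u hu
    rw [Finset.mem_filter, Finset.mem_range] at hu ⊢
    exact ⟨hu.1, h.lab_eq hu.1 hv hu.2⟩
  -- On either side, `v` is separated from the other side and from the smaller counts.
  have main : ∀ (β : ℕ) (A B : List ℕ), A.Nodup → B.Nodup → (∀ u ∈ A, u < n ∧ lab u = lab v) →
      (∀ u ∈ B, u < n ∧ lab u = lab v ∧ u ∉ A ∧ lab' u ≠ lab' v) →
      (∀ u ∈ A, oppCount H β B u < oppCount H β B v → lab' u ≠ lab' v) →
      ((Finset.range n).filter fun u => lab' u = lab' v).card + partners H β A B v ≤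
        ((Finset.range n).filter fun u => lab u = lab v).card := by
    intro β A B hA hB hAl hBl hAB
    set C := bucketSort (oppCount H β B) A (oppCount H β B v) with hC
    have nC : C.Nodup := nodup_bucketSort hA _
    have hd1 : Disjoint ((Finset.range n).filter fun u => lab' u = lab' v) B.toFinset := by
      rw [Finset.disjoint_left]
      intro u hu hu'
      exact (hBl u (List.mem_toFinset.1 hu')).2.2.2 (Finset.mem_filter.1 hu).2
    have hd2 : Disjoint (((Finset.range n).filter fun u => lab' u = lab' v) ∪ B.toFinset)
        C.toFinset := by
      rw [Finset.disjoint_left]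
      intro u hu hu'
      obtain ⟨hc1, hc2⟩ := mem_bucketSort.1 (List.mem_toFinset.1 hu')
      rcases Finset.mem_union.1 hu with hu | hu
      · exact hAB u hc1 hc2 (Finset.mem_filter.1 hu).2
      · exact (hBl u (List.mem_toFinset.1 hu)).2.2.1 hc1
    rw [partners, ← hC, ← List.toFinset_card_of_nodup hB, ← List.toFinset_card_of_nodup nC,
      ← add_assoc, ← Finset.card_union_of_disjoint hd1, ← Finset.card_union_of_disjoint hd2]
    refine Finset.card_le_card (Finset.union_subset (Finset.union_subset hmono ?_) ?_)
    · intro u hu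
      have := hBl u (List.mem_toFinset.1 hu)
      exact Finset.mem_filter.2 ⟨Finset.mem_range.2 this.1, this.2.1⟩
    · intro u hu
      have := hAl u (mem_bucketSort.1 (List.mem_toFinset.1 hu)).1
      exact Finset.mem_filter.2 ⟨Finset.mem_range.2 this.1, this.2⟩
  rcases h.cases v hv with h' | h' | h'
  · rw [← hL0, ← hL1] at h'
    rw [if_pos (List.mem_toFinset.2 h'.1), if_neg (fun h => h'.2.1 (List.mem_toFinset.1 h)),
      add_zero]
    refine main 0 L0 L1 n0 n1 ?_ ?_ ?_
    · intro u hu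
      have := mem_sideList.1 hu
      exact ⟨this.1, this.2.2.1.trans h'.2.2.2.1.symm⟩
    · intro u hu
      have h1 := mem_sideList.1 hu
      refine ⟨h1.1, h1.2.2.1.trans h'.2.2.2.1.symm, ?_, ?_⟩
      · rw [hL0, mem_sideList]
        simp_all
      · rw [h'.2.2.2.2, h.side1 u hu, code, code]
        omega
    · intro u hu hlt
      rw [h'.2.2.2.2, h.side0 u hu, ne_eq, code_inj]
      exact hlt.ne
  · rw [← hL0, ← hL1] at h'
    rw [if_pos (List.mem_toFinset.2 h'.1), if_neg (fun h => h'.2.1 (List.mem_toFinset.1 h)),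
      add_zero]
    refine main 1 L1 L0 n1 n0 ?_ ?_ ?_
    · intro u hu
      have := mem_sideList.1 hu
      exact ⟨this.1, this.2.2.1.trans h'.2.2.2.1.symm⟩
    · intro u hu
      have h1 := mem_sideList.1 hu
      refine ⟨h1.1, h1.2.2.1.trans h'.2.2.2.1.symm, ?_, ?_⟩
      · rw [hL1, mem_sideList]
        simp_all
      · rw [h'.2.2.2.2, h.side0 u hu, code, code]
        omega
    · intro u hu hlt
      rw [h'.2.2.2.2, h.side1 u hu, ne_eq, code_inj]
      exact hlt.ne
  · rw [← hL0, ← hL1] at h'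
    rw [if_neg (fun h => h'.1 (List.mem_toFinset.1 h)),
      if_neg (fun h => h'.2.1 (List.mem_toFinset.1 h)), add_zero, add_zero]
    exact Finset.card_le_card hmono

end WordRAM

/-! ### The recognition program -/

namespace WordRAM

variable {W n : ℕ} {s : State} {Q : State → ℕ → Prop} {H : SimpleGraph ℕ}

/-- Splits the class of the pivot in register `2` and tests the two sides. -/
def Program.pivotStep : Program := .seq .splitClass (.seq (.side 0 3 4) (.side 1 4 3))

theorem two_mul_succ_mul_le {x : ℕ} (hx : x < n) :
    2 * ((x + 1) * (n + 1)) ≤ 2 * (n * n) + 2 * n := by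
  have : (x + 1) * (n + 1) ≤ n * (n + 1) := Nat.mul_le_mul_right _ hx
  rw [Nat.mul_succ n n] at this
  omega

theorem WP.pivotStep {x : ℕ} {P : Prop} (hW : 2 * (n * n) + 8 * n + 8 ≤ W) (hM : Mat n H s)
    (hx : s.reg 2 = x) (hxn : x < n) (hlab : ∀ v < n, s.arr 2 v < 2 * ((x + 1) * (n + 1)))
    (hF : Flag s P)
    (hQ : ∀ s' t, Agree [1, 3, 4, 5, 6, 7, 8, 9, 10, 11] [2, 3, 4, 5] s s' →
      Refines n H x (s.arr 2) (s'.arr 2) →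
      Flag s' (P ∧ SideGood H 0 (sideList H (s.arr 2) x 0 n) (sideList H (s.arr 2) x 1 n) ∧
        SideGood H 1 (sideList H (s.arr 2) x 1 n) (sideList H (s.arr 2) x 0 n)) →
      t + 200 * samePairs n (s'.arr 2) ≤ 1000 * (n + 1) + 200 * samePairs n (s.arr 2) → Q s' t) :
    WP W .pivotStep Q s := by
  have hb := two_mul_succ_mul_le hxn
  have l0 := length_sideList_le (H := H) (lab := s.arr 2) (x := x) (β := 0) (n := n)
  have l1 := length_sideList_le (H := H) (lab := s.arr 2) (x := x) (β := 1) (n := n)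
  refine WP.seq (WP.splitClass hW hM hx hxn (fun v hv => (hlab v hv).trans_le (by omega))
    fun s1 t1 hs1 hA1 hB1 ht1 => ?_)
  have hM1 : Mat n H s1 := hM.congr (hs1.1 0 (by decide)) (hs1.2 1 (by decide))
  have a2 : s1.arr 2 = s.arr 2 := hs1.2 2 (by decide)
  refine WP.seq (WP.side hW (by omega) (Or.inl rfl) (Or.inr rfl) hM1 hA1 hB1
    ((hs1.1 2 (by decide)).trans hx) hxn (hF.congr (hs1.1 1 (by decide)) Iff.rfl)
    fun s2 t2 hs2 hlab2 hF2 ht2 => ?_)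
  refine WP.side hW (by omega) (Or.inr rfl) (Or.inl rfl)
    (hM1.congr (hs2.1 0 (by decide)) (hs2.2 1 (by decide)))
    (hB1.congr (hs2.1 4 (by decide)) (hs2.2 4 (by decide)))
    (hA1.congr (hs2.1 3 (by decide)) (hs2.2 3 (by decide)))
    ((hs2.1 2 (by decide)).trans ((hs1.1 2 (by decide)).trans hx)) hxn hF2
    fun s3 t3 hs3 hlab3 hF3 ht3 => ?_
  have hR : Refines n H x (s.arr 2) (s3.arr 2) := by
    refine ⟨hxn, hlab, ?_, ?_, ?_⟩
    · intro v hv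
      have hv' : v ∉ sideList H (s.arr 2) x 1 n := by
        rw [mem_sideList] at hv ⊢
        simp_all
      rw [hlab3, if_neg hv', hlab2, if_pos hv]
    · intro v hv
      rw [hlab3, if_pos hv]
    · intro v h0 h1
      rw [hlab3, if_neg h1, hlab2, if_neg h0, a2]
  have hsp := hR.samePairs_le
  refine hQ s3 _ ?_ hR (hF3.congr rfl and_assoc) (by omega)
  exact ((hs1.mono (by decide) (by decide)).trans (hs2.mono (by decide) (by decide))).trans
    (hs3.mono (by decide) (by decide))

/-- Decides whether the graph in array `1` is a cograph; the array `2` of the labels has to be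
zero. -/
def Program.cographTest : Program :=
  .seq (.assign 1 (.const 1)) (.seq (.forLoop 2 (.reg 0) .pivotStep) (.assign 0 (.reg 1)))

theorem WP.cographTest (hW : 2 * (n * n) + 8 * n + 8 ≤ W) (hM : Mat n H s)
    (hlab : ∀ v, s.arr 2 v = 0)
    (hQ : ∀ s' t, (P4FreeOn H {v | v < n} → s'.reg 0 = 1) →
      (¬ P4FreeOn H {v | v < n} → s'.reg 0 = 0) → t ≤ 2000 * ((n + 1) * (n + 1)) → Q s' t) :
    WP W .cographTest Q s := by
  have hΦ := samePairs_le (n := n) (lab := s.arr 2)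
  have hs0 : Agree [1] [] s (s.setReg 1 1) := (Agree.refl _ _ _).setReg (by decide) _
  have h1 : (s.setReg 1 1).reg 1 = 1 := by simp [State.setReg]
  refine WP.seq (WP.assign (by simp only [Expr.Fits]; omega) ?_)
  simp only [Expr.eval]
  generalize s.setReg 1 1 = s0 at *
  have hfree : P4FreeOn H {v | v < n} ↔ ClassesFree n H (s.arr 2) := by
    simp only [ClassesFree, hlab]
    constructor
    · intro h l
      exact h.mono fun v hv => hv.1
    · intro h
      exact (h 0).mono fun v hv => ⟨hv, rfl⟩
  -- The graph is a cograph if and only if all tests were passed so far and all current classes are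
  -- free of induced paths; the pivots used so far are alone in their classes.
  refine WP.seq (WP.forLoop (N := n) (fun x s' t =>
    (∃ P, Flag s' P ∧ (P4FreeOn H {v | v < n} ↔ P ∧ ClassesFree n H (s'.arr 2))) ∧
    (∀ v < n, s'.arr 2 v < 2 * ((x + 1) * (n + 1))) ∧
    (∀ u < x, ∀ v < n, s'.arr 2 v = s'.arr 2 u → v = u) ∧
    t + 200 * samePairs n (s'.arr 2) ≤ x * (1000 * (n + 1) + 10) + 200 * (n * n) + 2)
    (Program.pivotStep.regs) [4, 3, 2, 5, 2, 5] rfl rfl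
    (by omega) (by omega) (by decide) ?_ ?_ ?_ ?_)
  · intro s' hs
    have h0 : s'.reg 0 = n := (hs.1 0 (by decide)).trans ((hs0.1 0 (by decide)).trans hM.reg)
    simp only [Expr.Fits, Expr.eval, h0, and_true]
    omega
  · have a2 : (s0.setReg 2 0).arr 2 = s.arr 2 := hs0.2 2 (by decide)
    rw [a2]
    refine ⟨⟨True, Or.inl ⟨?_, trivial⟩, by rw [hfree, true_and]⟩, ?_, ?_, by omega⟩
    · simpa [State.setReg] using h1
    · intro v _
      rw [hlab]
      omega
    · exact fun u hu => absurd hu (Nat.not_lt_zero u)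
  · rintro x hx s' t hs hx' ⟨⟨P, hF, hP⟩, hlt, hsing, ht⟩
    have hM' : Mat n H s' := hM.congr ((hs.1 0 (by decide)).trans (hs0.1 0 (by decide)))
      ((hs.2 1 (by decide)).trans (hs0.2 1 (by decide)))
    refine WP.pivotStep hW hM' hx' hx hlt hF fun s2 t2 hs2 hR hF2 ht2 => ?_
    have ht' : (x + 1) * (1000 * (n + 1) + 10) = x * (1000 * (n + 1) + 10) +
      (1000 * (n + 1) + 10) := Nat.succ_mul _ _
    refine ⟨⟨_, hF2.congr (by simp [State.setReg]) Iff.rfl, ?_⟩, ?_, ?_, ?_⟩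
    · rw [hP, hR.classesFree_iff, ← and_assoc]
      rfl
    · intro v hv
      exact hR.lab_lt' hv
    · intro u hu v hv huv
      rcases Nat.lt_succ_iff_lt_or_eq.1 hu with hu | rfl
      · exact hsing u hu v hv (hR.lab_eq hv (by omega) huv)
      · exact hR.lab_pivot hv huv
    · simp only [Expr.cost]
      change _ + 200 * samePairs n (s2.arr 2) ≤ _
      omega
  · rintro s' t hs ⟨⟨P, hF, hP⟩, -, hsing, ht⟩
    -- In the end, all classes are singletons.
    have hfree' : ClassesFree n H (s'.arr 2) := by
      rintro l a ⟨ha, hal⟩ b ⟨hb, hbl⟩ c hc d hd h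
      exact h.1.ne (hsing b hb a ha (hal.trans hbl.symm))
    rw [and_iff_left hfree'] at hP
    have hr1 : s'.reg 1 ≤ 1 := by
      rcases hF with h | h <;> omega
    refine WP.assign (by simp only [Expr.Fits]; omega) (hQ _ _ ?_ ?_ ?_)
    · intro h
      rcases hF with hF | hF
      · simpa [State.setReg, Expr.eval] using hF.1
      · exact absurd (hP.1 h) hF.2
    · intro h
      rcases hF with hF | hF
      · exact absurd (hP.2 hF.2) h
      · simpa [State.setReg, Expr.eval] using hF.1
    · have e1 : n * (1000 * (n + 1) + 10) = 1000 * (n * n) + 1010 * n := by ring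
      have e2 : 2000 * ((n + 1) * (n + 1)) = 2000 * (n * n) + 4000 * n + 2000 := by ring
      simp only [Expr.cost]
      omega

/-- Writes the adjacency matrix of the switch of the input graph with respect to the neighbourhood
of the vertex `0` into array `1`. -/
def Program.switchInput : Program :=
  .forLoop 5 (.reg 0) (.forLoop 6 (.reg 0) (.write 1
    (.bin .add (.bin .mul (.reg 5) (.reg 0)) (.reg 6))
    (.bin .eq (.bin .eq (.read 0 (.bin .add (.bin .mul (.reg 5) (.reg 0)) (.reg 6)))
      (.read 0 (.reg 5))) (.read 0 (.reg 6)))))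

/-- The graph `G` on the vertices `0, …, n - 1`, with the further natural numbers as isolated
vertices. -/
def onNat {n : ℕ} (G : SimpleGraph (Fin n)) : SimpleGraph ℕ := G.map Fin.val

theorem onNat_adj {n : ℕ} {G : SimpleGraph (Fin n)} {u v : ℕ} :
    (onNat G).Adj u v ↔ ∃ i j : Fin n, G.Adj i j ∧ (i : ℕ) = u ∧ (j : ℕ) = v := by
  constructor
  · rintro ⟨-, i, j, h, rfl, rfl⟩
    exact ⟨i, j, h, rfl, rfl⟩
  · rintro ⟨i, j, h, rfl, rfl⟩
    exact ⟨fun h' => h.ne (Fin.ext h'), i, j, h, rfl, rfl⟩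

theorem inputGraph_arr {n : ℕ} (G : SimpleGraph (Fin n)) {u v : ℕ} (hu : u < n) (hv : v < n) :
    ((inputGraph G).arr 0 (u * n + v) = 1 ∧ (onNat G).Adj u v) ∨
      ((inputGraph G).arr 0 (u * n + v) = 0 ∧ ¬ (onNat G).Adj u v) := by
  have hadj : (∃ i j : Fin n, u * n + v = i * n + j ∧ G.Adj i j) ↔
      (onNat G).Adj u v := by
    rw [onNat_adj]
    constructor
    · rintro ⟨i, j, hij, h⟩
      have h1 : (v + n * u) / n = (j + n * i) / n := by
        rw [add_comm v, add_comm (j : ℕ), mul_comm n, mul_comm n, hij]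
      have hn : 0 < n := by omega
      rw [Nat.add_mul_div_left _ _ hn, Nat.add_mul_div_left _ _ hn, Nat.div_eq_of_lt hv,
        Nat.div_eq_of_lt j.2, zero_add, zero_add] at h1
      refine ⟨i, j, h, h1.symm, ?_⟩
      rw [h1] at hij
      exact (Nat.add_left_cancel hij).symm
    · rintro ⟨i, j, h, rfl, rfl⟩
      exact ⟨i, j, rfl, h⟩
  by_cases h : (onNat G).Adj u v
  · refine Or.inl ⟨?_, h⟩
    simp [inputGraph, hadj.2 h]
  · refine Or.inr ⟨?_, h⟩
    have := mt hadj.1 h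
    exact if_neg fun h => this h.2

/-- For truth values `p`, `q`, `r`, the expression `(p = q) = r` has the parity of `p + q + r`,
which is the adjacency in the switched graph. -/
theorem WP.switchInput {n : ℕ} (G : SimpleGraph (Fin n)) (hW : 2 * (n * n) + 8 * n + 8 ≤ W)
    (hQ : ∀ s' t, Agree [5, 6] [1] (inputGraph G) s' →
      Mat n (seidelSwitch (onNat G) ((onNat G).neighborSet 0)) s' →
      t ≤ 100 * ((n + 1) * (n + 1)) → Q s' t) :
    WP W .switchInput Q (inputGraph G) := by
  set H := seidelSwitch (onNat G) ((onNat G).neighborSet 0) with hH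
  have h00 : (inputGraph G).reg 0 = n := by simp [inputGraph]
  have fits : ∀ s' : State, s'.reg 0 = n → (Expr.reg 0).Fits W s' ∧ (Expr.reg 0).eval s' = n := by
    intro s' h
    simp only [Expr.Fits, Expr.eval, h, and_true]
    omega
  let Ok : State → ℕ → ℕ → Prop := fun s u v => (s.arr 1 (u * n + v) = 1 ∧ H.Adj u v) ∨
    (s.arr 1 (u * n + v) = 0 ∧ ¬ H.Adj u v)
  refine WP.forLoop (N := n) (fun i s' t => (∀ u < i, ∀ v < n, Ok s' u v) ∧
    t ≤ i * (50 * n + 50) + 2) [6, 6] [1] rfl rfl (by omega) (by omega) (by decide) ?_ ?_ ?_ ?_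
  · exact fun s' hs => fits s' ((hs.1 0 (by decide)).trans h00)
  · exact ⟨fun u hu => absurd hu (Nat.not_lt_zero u), by omega⟩
  · rintro i hi s' t hs hi' ⟨hOk, ht⟩
    have ht' : (i + 1) * (50 * n + 50) = i * (50 * n + 50) + (50 * n + 50) := Nat.succ_mul _ _
    refine WP.forLoop (N := n) (fun j s' t => (∀ u < i, ∀ v < n, Ok s' u v) ∧
      (∀ v < j, Ok s' i v) ∧ t ≤ j * 50 + 2) [] [1] rfl rfl
      (by omega) (by omega) (by decide) ?_ ?_ ?_ ?_
    · exact fun s2 hs2 => fits s2 ((hs2.1 0 (by decide)).trans ((hs.1 0 (by decide)).trans h00))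
    · exact ⟨hOk, fun u hu => absurd hu (Nat.not_lt_zero u), by omega⟩
    · rintro j hj s2 t2 hs2 hj' ⟨hOk2, hOki, ht2⟩
      have h5 : s2.reg 5 = i := (hs2.1 5 (by decide)).trans hi'
      have h0 : s2.reg 0 = n := (hs2.1 0 (by decide)).trans ((hs.1 0 (by decide)).trans h00)
      have a0 : s2.arr 0 = (inputGraph G).arr 0 := (hs2.2 0 (by decide)).trans (hs.2 0 (by decide))
      have hij := mul_add_lt_sq hi hj
      have k1 := inputGraph_arr G hi hj
      have k2 := inputGraph_arr G (show 0 < n by omega) hi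
      have k3 := inputGraph_arr G (show 0 < n by omega) hj
      rw [zero_mul, zero_add] at k2 k3
      have hadj : H.Adj i j ↔ ((onNat G).Adj i j ↔
          ((onNat G).Adj 0 i ↔ (onNat G).Adj 0 j)) := by
        rw [hH, seidelSwitch_adj, mem_neighborSet, mem_neighborSet]
      have hone : ∀ p : Prop, [Decidable p] → (if p then 1 else 0) < W := by
        intro p _
        split_ifs <;> omega
      refine WP.write ?_ ?_ ⟨?_, ?_, ?_⟩
      · simp only [Expr.Fits, Expr.eval, BinOp.apply, h0, h5, hj']
        omega
      · simp only [Expr.Fits, Expr.eval, BinOp.apply, h0, h5, hj', a0]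
        refine ⟨⟨⟨⟨⟨?_, ?_, ?_⟩, ?_, ?_⟩, ?_⟩, ⟨?_, ?_⟩, hone _⟩, ⟨?_, ?_⟩, hone _⟩ <;> omega
      · intro u hu v hv
        have hne : u * n + v ≠ i * n + j := by
          have : (u + 1) * n ≤ i * n := Nat.mul_le_mul_right n hu
          rw [Nat.succ_mul] at this
          omega
        simpa [Ok, State.setReg, State.setArr, Expr.eval, BinOp.apply, h0, h5, hj', hne] using
          hOk2 u hu v hv
      · intro v hv
        rcases Nat.lt_succ_iff_lt_or_eq.1 hv with hv | rfl
        · simpa [Ok, State.setReg, State.setArr, Expr.eval, BinOp.apply, h0, h5, hj', hv.ne] using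
            hOki v hv
        · simp only [Ok, hadj, State.setReg, State.setArr, Expr.eval, BinOp.apply, h0, h5, hj', a0,
            Function.update_self]
          rcases k1 with ⟨k1, k1'⟩ | ⟨k1, k1'⟩ <;> rcases k2 with ⟨k2, k2'⟩ | ⟨k2, k2'⟩ <;>
            rcases k3 with ⟨k3, k3'⟩ | ⟨k3, k3'⟩ <;> simp [k1, k1', k2, k2', k3, k3']
      · simp only [Expr.cost]
        omega
    · rintro s2 t2 hs2 ⟨hOk2, hOki, ht2⟩
      refine ⟨?_, ?_⟩
      · intro u hu
        rcases Nat.lt_succ_iff_lt_or_eq.1 hu with hu | rfl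
        exacts [hOk2 u hu, hOki]
      · simp only [Expr.cost]
        omega
  · rintro s' t hs ⟨hOk, ht⟩
    refine hQ s' _ (hs.mono (by decide) (by decide)) ⟨(hs.1 0 (by decide)).trans h00, hOk⟩ ?_
    have e1 : n * (50 * n + 50) = 50 * (n * n) + 50 * n := by ring
    have e2 : 100 * ((n + 1) * (n + 1)) = 100 * (n * n) + 200 * n + 100 := by ring
    simp only [Expr.cost]
    omega

/-- Decides whether the input graph is Cameron. -/
def Program.cameronTest : Program := .seq .switchInput .cographTest

theorem isCameron_iff_p4FreeOn {n : ℕ} (G : SimpleGraph (Fin n)) :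
    IsCameron G ↔ P4FreeOn (seidelSwitch (onNat G)
      ((onNat G).neighborSet 0)) {v | v < n} := by
  rcases Nat.eq_zero_or_pos n with rfl | hn
  · constructor
    · intro _ a ha
      exact absurd ha (Nat.not_lt_zero a)
    · intro _
      exact ⟨G, ∅, fun ⟨f⟩ => (f 0).elim0, by ext u; exact u.elim0⟩
  · have hmap : ∀ u v : Fin n, (onNat G).Adj u v ↔ G.Adj u v := by
      intro u v
      rw [onNat_adj]
      constructor
      · rintro ⟨i, j, h, hi, hj⟩
        rwa [← Fin.ext hi, ← Fin.ext hj]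
      · exact fun h => ⟨u, v, h, rfl, rfl⟩
    have hadj : ∀ u v : Fin n, (seidelSwitch (onNat G)
        ((onNat G).neighborSet 0)).Adj u v ↔
        (seidelSwitch G (G.neighborSet ⟨0, hn⟩)).Adj u v := by
      intro u v
      have h0 := hmap ⟨0, hn⟩
      rw [seidelSwitch_adj, seidelSwitch_adj, mem_neighborSet, mem_neighborSet, mem_neighborSet,
        mem_neighborSet, hmap, ← h0, ← h0]
    rw [isCameron_iff G ⟨0, hn⟩, isCograph_iff]
    constructor
    · intro h a ha b hb c hc d hd h4
      refine h ⟨a, ha⟩ ⟨b, hb⟩ ⟨c, hc⟩ ⟨d, hd⟩ ?_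
      simpa only [InducesP4, ← hadj] using h4
    · intro h a b c d h4
      refine h a a.2 b b.2 c c.2 d d.2 ?_
      simpa only [InducesP4, hadj] using h4

theorem Program.cameronTest_recognizes :
    Program.cameronTest.Recognizes (fun _ G => IsCameron G)
      (fun n => 2100 * ((n + 1) * (n + 1))) := by
  refine ⟨4, fun n G => ?_⟩
  have hW : 2 * (n * n) + 8 * n + 8 ≤ (n + 2) ^ 4 := by
    have h1 : (n + 2) ^ 4 = ((n + 2) * (n + 2)) * ((n + 2) * (n + 2)) := by ring
    have h2 : 2 * (n * n) + 8 * n + 8 = ((n + 2) * (n + 2)) * 2 := by ring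
    rw [h1, h2]
    exact Nat.mul_le_mul_left _ (by nlinarith)
  have hfin : WP ((n + 2) ^ 4) .cameronTest (fun s t => t ≤ 2100 * ((n + 1) * (n + 1)) ∧
      (IsCameron G → s.reg 0 = 1) ∧ (¬ IsCameron G → s.reg 0 = 0)) (inputGraph G) := by
    rw [isCameron_iff_p4FreeOn]
    refine WP.seq (WP.switchInput G hW fun s1 t1 hs1 hM1 ht1 => ?_)
    refine WP.cographTest hW hM1 ?_ fun s2 t2 h1 h0 ht2 => ⟨by omega, h1, h0⟩
    intro v
    rw [hs1.2 2 (by decide)]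
    simp [inputGraph]
  exact hfin

theorem isBigO_succ_sq : (fun n : ℕ => ((2100 * ((n + 1) * (n + 1)) : ℕ) : ℝ)) =O[atTop]
    fun n : ℕ => (n : ℝ) ^ 2 := by
  refine IsBigO.of_bound 8400 (eventually_atTop.2 ⟨1, fun n hn => ?_⟩)
  have hn' : (1 : ℝ) ≤ n := by exact_mod_cast hn
  rw [Real.norm_of_nonneg (by positivity), Real.norm_of_nonneg (by positivity)]
  push_cast
  nlinarith

end WordRAM

theorem mainTheorem3 :
    (∃ (p : WordRAM.Program) (T : ℕ → ℕ),
      ((fun n : ℕ => (T n : ℝ)) =O[atTop] fun n : ℕ => (n : ℝ) ^ 2) ∧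
        p.Recognizes (fun _ G => IsCameron G) T) ∧
    (∀ (V : Type*) (G : SimpleGraph V) (x : V),
      IsCameron G ↔ IsCograph (seidelSwitch G (G.neighborSet x))) :=
  ⟨⟨_, _, WordRAM.isBigO_succ_sq, WordRAM.Program.cameronTest_recognizes⟩,
    fun _ G x => isCameron_iff G x⟩
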